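/- Let $\mathbb F$ be an algebraically closed field (of arbitrary characteristic), let $n\ge 1$, and let $\mathcal Z\subset \mathrm{Mat}_{n\times n}(\mathbb F)=\mathbb F^{n^2}$ be an affine variety, i.e. a nonempty irreducible Zariski-closed subset. Identify the monic polynomial $\lambda^n+b_1\lambda^{n-1}+\dots+b_n$ with the point $(b_1,\dots,b_n)\in\mathbb F^n$, and call a subset of $\mathbb F^m$ generic if it contains a nonempty Zariski-open subset of $\mathbb F^m$. The multiplicative inverse eigenvalue problem for $\mathcal Z$ is called generically solvable if there is a generic set of matrices $M\in\mathrm{Mat}_{n\times n}(\mathbb F)$ such that, for each such $M$, the set of monic polynomials $p$ of degree $n$ for which some $Z\in\mathcal Z$ satisfies $$\det(\lambda I-MZ)=p(\lambda)$$ is generic in $\mathbb F^n$. Then the problem is generically solvable if and only if $\dim\mathcal Z\ge n$ and the function $Z\mapsto\det Z$ is not constant on $\mathcal Z$. -/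

import Mathlib

open Polynomial

noncomputable section

namespace InverseEigenvalue

/-- Zariski closed subsets of the affine space `F^σ`. -/
def IsZariskiClosed {F : Type*} [Field F] {σ : Type*} (S : Set (σ → F)) : Prop :=
  ∃ I : Ideal (MvPolynomial σ F), S = MvPolynomial.zeroLocus F I

/-- A (closed, irreducible) affine variety in the affine space `F^σ`: a nonempty Zariski closed
set that is not the union of two proper Zariski closed subsets. -/
structure IsAffineVariety {F : Type*} [Field F] {σ : Type*} (S : Set (σ → F)) : Prop where
  closed : IsZariskiClosed S
  nonempty : S.Nonempty
  irreducible : ∀ A B : Set (σ → F), IsZariskiClosed A → IsZariskiClosed B →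
    S ⊆ A ∪ B → S ⊆ A ∨ S ⊆ B

/-- The coordinate ring `F[σ] / I(S)`. -/
abbrev CoordinateRing {F : Type*} [Field F] {σ : Type*} (S : Set (σ → F)) : Type _ :=
  MvPolynomial σ F ⧸ MvPolynomial.vanishingIdeal F S

/-- The dimension of an affine variety: the Krull dimension of its coordinate ring. -/
def varietyDim {F : Type*} [Field F] {σ : Type*} (S : Set (σ → F)) : WithBot ℕ∞ :=
  ringKrullDim (CoordinateRing S)

/-- A generic set: one that contains a nonempty Zariski open subset of `F^σ`. -/
def IsGeneric {F : Type*} [Field F] {σ : Type*} (U : Set (σ → F)) : Prop :=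
  ∃ O : Set (σ → F), IsZariskiClosed Oᶜ ∧ O.Nonempty ∧ O ⊆ U

/-- The identification of `n × n` matrices with points of the affine space `F^(n × n)`. -/
def matrixCoords {F : Type*} {n : ℕ} (M : Matrix (Fin n) (Fin n) F) : Fin n × Fin n → F :=
  fun ij => M ij.1 ij.2

/-- The monic polynomial `λ^n + b_1 λ^(n-1) + ⋯ + b_n` attached to a point of `F^n`; the
coordinate `b i` (with `i` starting at `0`) is the coefficient of `λ^(n-1-i)`. -/
def monicPoly {F : Type*} [Field F] {n : ℕ} (b : Fin n → F) : F[X] :=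
  X ^ n + ∑ i : Fin n, C (b i) * X ^ (n - 1 - (i : ℕ))

/-- The (right) multiplicative inverse eigenvalue problem for `𝒵`, `M` and `p` has a solution:
some `Z ∈ 𝒵` has `det (λ I - M Z) = p`. -/
def HasSolution {F : Type*} [Field F] {n : ℕ} (𝒵 : Set (Matrix (Fin n) (Fin n) F))
    (M : Matrix (Fin n) (Fin n) F) (p : F[X]) : Prop :=
  ∃ Z ∈ 𝒵, (M * Z).charpoly = p

/-- For a generic set of matrices `M`, the problem is solvable for a generic set of monic
polynomials of degree `n`. -/
def GenericallySolvable {F : Type*} [Field F] {n : ℕ}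
    (𝒵 : Set (Matrix (Fin n) (Fin n) F)) : Prop :=
  IsGeneric (matrixCoords '' {M : Matrix (Fin n) (Fin n) F |
    IsGeneric {b : Fin n → F | HasSolution 𝒵 M (monicPoly b)}})

end InverseEigenvalue

end

noncomputable section

universe u

namespace InverseEigenvalue

/-! Necessity already follows from a single good `M`. A polynomial relation among the coefficient
functions of `charpoly (M * Z)` on the variety would hold on a dense set of polynomials, so these
`n` functions are algebraically independent and the dimension is at least `n`. A constant
determinant would fix the constant term.

For sufficiency, let `z` be the generic point of the variety and let `M` have indeterminate entries.
If the entries of `M` and the `n` coefficients of `charpoly (M * z)` are algebraically independent,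
then `(M, Z) ↦ (M, charpoly (M * Z))` is dominant. By Chevalley (`exists_ne_zero_forall_lift`) its
image contains a basic open set, and slicing that set gives the two nested generic conditions.

To prove independence, `det z` is transcendental, and it is absorbed into the base field: over the
algebraic closure `K` of `F(det z)`, transcendence degree at least `n - 1` remains, and `n - 1`
coefficients have to be treated. The Jacobian criterion is applied with derivations `D` of `L =
K(z)` over `K`. At a specialization with `M * z = Q * diag(t) * P`, `P = Q⁻¹` and distinct nonzero
`t j`, a derivation that kills every coefficient makes the diagonal of `P * (z⁻¹ * D z) * Q` vanish.
The matrices `z⁻¹ * D z` range over an `(n - 1)`-dimensional space, and `exists_diag_injective`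
supplies a conjugation after which no nonzero member of that space has zero diagonal. -/

/-! ### Rank under quadratic perturbation. -/

theorem exists_linearIndependent_quadratic_perturbation {K V ι : Type*} [Field K] [Infinite K]
    [AddCommGroup V] [Module K V] [Finite ι] {v : ι → V} (w u : ι → V)
    (hv : LinearIndependent K v) :
    ∃ t : K, t ≠ 0 ∧ LinearIndependent K (fun i => v i + t • w i + t ^ 2 • u i) := by
  classical
  cases nonempty_fintype ι
  obtain ⟨π, hπ⟩ := LinearMap.exists_leftInverse_of_injective (Fintype.linearCombination K v)
    (LinearMap.ker_eq_bot.mpr (linearIndependent_iff_injective_fintypeLinearCombination.mp hv))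
  have hπv : ∀ i, π (v i) = Pi.single i 1 := fun i => by
    have := LinearMap.congr_fun hπ (Pi.single i (1 : K))
    simpa [Fintype.linearCombination_apply_single] using this
  let W : Matrix ι ι K := Matrix.of fun i j => π (w i) j
  let U : Matrix ι ι K := Matrix.of fun i j => π (u i) j
  let p : K[X] := (1 + (X : K[X]) • W.map (C : K → K[X]) +
    (X ^ 2 : K[X]) • U.map (C : K → K[X])).det
  have hp : ∀ t, p.eval t = (1 + t • W + t ^ 2 • U : Matrix ι ι K).det := fun t => by
    simp only [p]
    rw [← coe_evalRingHom, RingHom.map_det]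
    congr 1
    ext i j
    by_cases h : i = j <;> simp [h] <;> ring
  -- `p` has value 1 at 0; the extra factor `X` forces the chosen `t` to be nonzero.
  have hp0 : X * p ≠ 0 := by
    refine mul_ne_zero X_ne_zero fun h => ?_
    have := hp 0
    simp [h] at this
  obtain ⟨t, ht⟩ : ∃ t, (X * p).eval t ≠ 0 := by
    by_contra! h
    exact hp0 (Polynomial.funext fun t => by simpa using h t)
  rw [eval_mul, eval_X, mul_ne_zero_iff] at ht
  refine ⟨t, ht.1, LinearIndependent.of_comp π ?_⟩
  have h1 : IsUnit (1 + t • W + t ^ 2 • U : Matrix ι ι K) := by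
    rw [Matrix.isUnit_iff_isUnit_det, ← hp, isUnit_iff_ne_zero]
    exact ht.2
  have h2 := Matrix.linearIndependent_rows_of_isUnit h1
  have h3 : (π ∘ fun i => v i + t • w i + t ^ 2 • u i) =
      (1 + t • W + t ^ 2 • U : Matrix ι ι K).row := by
    ext i j
    simp [hπv, W, U, Matrix.row, Matrix.one_apply, Pi.single_apply, eq_comm]
  rwa [h3]

/-- The perturbed map sends `t⁻¹ • x` exactly to `f₁ x`, a direction outside the old range, while
perturbed images of a lifted basis of that range stay independent together with it. -/
theorem exists_finrank_range_lt_quadratic_perturbation {K V W : Type*} [Field K] [Infinite K]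
    [AddCommGroup V] [Module K V] [AddCommGroup W] [Module K W] [FiniteDimensional K V]
    (f₀ f₁ f₂ : V →ₗ[K] W) {x : V} (h₀ : f₀ x = 0) (h₁ : f₁ x ∉ LinearMap.range f₀)
    (h₂ : f₂ x = 0) :
    ∃ t : K, t ≠ 0 ∧ Module.finrank K (LinearMap.range f₀) <
      Module.finrank K (LinearMap.range (f₀ + t • f₁ + t ^ 2 • f₂)) := by
  let b := Module.finBasis K (LinearMap.range f₀)
  choose a ha using fun i => LinearMap.mem_range.mp (b i).2
  let v : Option (Fin (Module.finrank K (LinearMap.range f₀))) → W := fun o =>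
    o.elim (f₁ x) (fun i => f₀ (a i))
  have hv : LinearIndependent K v := by
    have hb : LinearIndependent K (fun i => (b i : W)) :=
      b.linearIndependent.map' (LinearMap.range f₀).subtype
        (Submodule.ker_subtype (LinearMap.range f₀))
    refine linearIndependent_option.2 ⟨?_, fun h => h₁ ?_⟩
    · simpa [v, Function.comp_def, ha] using hb
    · refine Submodule.span_le.2 ?_ h
      rintro _ ⟨i, rfl⟩
      exact ⟨a i, rfl⟩
  obtain ⟨t, ht, hi⟩ := exists_linearIndependent_quadratic_perturbation
    (fun o => o.elim 0 (fun i => f₁ (a i))) (fun o => o.elim 0 (fun i => f₂ (a i))) hv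
  refine ⟨t, ht, ?_⟩
  have hle := finrank_span_eq_card hi
  rw [Fintype.card_option, Fintype.card_fin] at hle
  rw [Nat.lt_iff_add_one_le, ← hle]
  apply Submodule.finrank_mono
  rw [Submodule.span_le]
  rintro _ ⟨_ | i, rfl⟩
  · refine ⟨t⁻¹ • x, ?_⟩
    simp [v, h₀, h₂, ht]
  · exact ⟨a i, by simp [v]⟩

/-! ### Conjugating a space of matrices: the block diagonal part of type `(1, ι)`. -/

section Block

variable {K ι : Type*} [Field K] [Fintype ι] [DecidableEq ι]

/-- The projection of a matrix onto its block diagonal part of type `(1, ι)`. -/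
def blockDiagPart (K ι : Type*) [Field K] :
    Matrix (Unit ⊕ ι) (Unit ⊕ ι) K →ₗ[K] K × Matrix ι ι K where
  toFun X := (X (Sum.inl ()) (Sum.inl ()), X.toBlocks₂₂)
  map_add' _ _ := rfl
  map_smul' _ _ := rfl

omit [Fintype ι] [DecidableEq ι] in
@[simp] theorem blockDiagPart_apply (X : Matrix (Unit ⊕ ι) (Unit ⊕ ι) K) :
    blockDiagPart K ι X = (X (Sum.inl ()) (Sum.inl ()), X.toBlocks₂₂) := rfl

/-- Left and right multiplication of a linear family of matrices. -/
def mulLeftRight {n V : Type*} [Fintype n] [AddCommGroup V] [Module K V] (P Q : Matrix n n K)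
    (θ : V →ₗ[K] Matrix n n K) : V →ₗ[K] Matrix n n K :=
  LinearMap.mulRight K Q ∘ₗ LinearMap.mulLeft K P ∘ₗ θ

@[simp] theorem mulLeftRight_apply {n V : Type*} [Fintype n] [AddCommGroup V] [Module K V]
    (P Q : Matrix n n K) (θ : V →ₗ[K] Matrix n n K) (v : V) :
    mulLeftRight P Q θ v = P * θ v * Q := rfl

theorem mulLeftRight_mulLeftRight {n V : Type*} [Fintype n] [AddCommGroup V]
    [Module K V] (P Q P' Q' : Matrix n n K) (θ : V →ₗ[K] Matrix n n K) :
    mulLeftRight P Q (mulLeftRight P' Q' θ) = mulLeftRight (P * P') (Q' * Q) θ := by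
  ext1 v
  simp [Matrix.mul_assoc]

theorem mulLeftRight_injective {n V : Type*} [Fintype n] [DecidableEq n] [AddCommGroup V]
    [Module K V] {P Q : Matrix n n K} (h : P * Q = 1) {θ : V →ₗ[K] Matrix n n K}
    (hθ : Function.Injective θ) : Function.Injective (mulLeftRight P Q θ) := by
  have h' := mul_eq_one_comm.mp h
  intro a b hab
  apply hθ
  have : Q * (P * θ a * Q) * P = Q * (P * θ b * Q) * P := by
    simpa using congrArg (fun X => Q * X * P) hab
  have key : ∀ X, Q * (P * X * Q) * P = X := fun X => by
    calc Q * (P * X * Q) * P = (Q * P) * X * (Q * P) := by noncomm_ring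
      _ = X := by rw [h']; simp
  rwa [key, key] at this

theorem one_add_mul_one_sub {n : Type*} [Fintype n] [DecidableEq n] {E : Matrix n n K}
    (hE : E * E = 0) (t : K) : (1 + t • E) * (1 - t • E) = 1 := by
  simp [add_mul, mul_sub, hE]

theorem mulLeftRight_one_add {n V : Type*} [Fintype n] [DecidableEq n] [AddCommGroup V]
    [Module K V] (E : Matrix n n K) (t : K) (θ : V →ₗ[K] Matrix n n K) :
    mulLeftRight (1 + t • E) (1 - t • E) θ =
      θ + t • (mulLeftRight E 1 θ - mulLeftRight 1 E θ) + t ^ 2 • (-mulLeftRight E E θ) := by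
  ext1 v
  simp only [mulLeftRight_apply, LinearMap.add_apply, LinearMap.smul_apply, LinearMap.sub_apply,
    LinearMap.neg_apply, add_mul, mul_sub, one_mul, mul_one, smul_mul_assoc, mul_smul_comm,
    sq]
  module

variable {V : Type*} [AddCommGroup V] [Module K V] [FiniteDimensional K V] [Infinite K]

/-- Since `E * E = 0`, conjugation by `1 + t • E` is quadratic in `t`, with the commutator as linear
term and `-E X E` as quadratic term. -/
theorem exists_finrank_range_lt_of_commutator {θ : V →ₗ[K] Matrix (Unit ⊕ ι) (Unit ⊕ ι) K}
    {E : Matrix (Unit ⊕ ι) (Unit ⊕ ι) K} (hE : E * E = 0) {x : V}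
    (h₀ : blockDiagPart K ι (θ x) = 0) (h₂ : blockDiagPart K ι (E * θ x * E) = 0)
    (h₁ : blockDiagPart K ι (E * θ x - θ x * E) ∉ LinearMap.range (blockDiagPart K ι ∘ₗ θ)) :
    ∃ P Q : Matrix (Unit ⊕ ι) (Unit ⊕ ι) K, P * Q = 1 ∧
      Module.finrank K (LinearMap.range (blockDiagPart K ι ∘ₗ θ)) <
        Module.finrank K (LinearMap.range (blockDiagPart K ι ∘ₗ mulLeftRight P Q θ)) := by
  obtain ⟨t, ht, h⟩ := exists_finrank_range_lt_quadratic_perturbation (blockDiagPart K ι ∘ₗ θ)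
    (blockDiagPart K ι ∘ₗ (mulLeftRight E 1 θ - mulLeftRight 1 E θ))
    (blockDiagPart K ι ∘ₗ (-mulLeftRight E E θ)) (x := x) h₀ (by simpa using h₁)
    (by simpa using h₂)
  refine ⟨_, _, one_add_mul_one_sub hE t, ?_⟩
  rw [mulLeftRight_one_add, LinearMap.comp_add, LinearMap.comp_add, LinearMap.comp_smul,
    LinearMap.comp_smul]
  exact h

theorem exists_blockDiagPart_injective_perturbation
    {θ : V →ₗ[K] Matrix (Unit ⊕ ι) (Unit ⊕ ι) K}
    (E : Matrix (Unit ⊕ ι) (Unit ⊕ ι) K)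
    (h : Function.Injective (blockDiagPart K ι ∘ₗ θ)) :
    ∃ t : K, t ≠ 0 ∧ Function.Injective
      (blockDiagPart K ι ∘ₗ mulLeftRight (1 + t • E) (1 - t • E) θ) := by
  let b := Module.finBasis K V
  obtain ⟨t, ht, hi⟩ := exists_linearIndependent_quadratic_perturbation
    (fun i => (blockDiagPart K ι ∘ₗ (mulLeftRight E 1 θ - mulLeftRight 1 E θ)) (b i))
    (fun i => (blockDiagPart K ι ∘ₗ (-mulLeftRight E E θ)) (b i))
    (b.linearIndependent.map' _ (LinearMap.ker_eq_bot.mpr h))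
  refine ⟨t, ht, ?_⟩
  rw [injective_iff_map_eq_zero]
  intro v hv
  refine b.ext_elem fun i => ?_
  rw [map_zero, Finsupp.zero_apply]
  refine Fintype.linearIndependent_iff.mp hi (fun i => b.repr v i) ?_ i
  rw [← hv]
  conv_rhs => rw [← b.sum_repr v]
  rw [map_sum]
  refine Finset.sum_congr rfl fun i _ => ?_
  rw [map_smul, mulLeftRight_one_add, LinearMap.comp_add, LinearMap.comp_add, LinearMap.comp_smul,
    LinearMap.comp_smul]
  rfl

/-- The matrix whose only nonzero block is the row `φ`. -/
def rowBlock (K ι : Type*) [Field K] : (ι → K) →ₗ[K] Matrix (Unit ⊕ ι) (Unit ⊕ ι) K where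
  toFun φ := Matrix.fromBlocks 0 (Matrix.replicateRow Unit φ) 0 0
  map_add' _ _ := by simp [Matrix.fromBlocks_add]
  map_smul' _ _ := by simp [Matrix.fromBlocks_smul]

/-- The matrix whose only nonzero block is the column `φ`. -/
def colBlock (K ι : Type*) [Field K] : (ι → K) →ₗ[K] Matrix (Unit ⊕ ι) (Unit ⊕ ι) K where
  toFun φ := Matrix.fromBlocks 0 0 (Matrix.replicateCol Unit φ) 0
  map_add' _ _ := by simp [Matrix.fromBlocks_add]
  map_smul' _ _ := by simp [Matrix.fromBlocks_smul]

omit [Infinite K] in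
theorem rowBlock_mul_self (φ : ι → K) : rowBlock K ι φ * rowBlock K ι φ = 0 := by
  simp [rowBlock, Matrix.fromBlocks_multiply]

omit [Infinite K] in
theorem colBlock_mul_self (φ : ι → K) : colBlock K ι φ * colBlock K ι φ = 0 := by
  simp [colBlock, Matrix.fromBlocks_multiply]

omit [Fintype ι] [DecidableEq ι] [Infinite K] in
theorem eq_rowBlock_add_colBlock {X : Matrix (Unit ⊕ ι) (Unit ⊕ ι) K}
    (h : blockDiagPart K ι X = 0) :
    X = rowBlock K ι (fun j => X (Sum.inl ()) (Sum.inr j)) +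
      colBlock K ι (fun i => X (Sum.inr i) (Sum.inl ())) := by
  have h1 : X (Sum.inl ()) (Sum.inl ()) = 0 := congrArg Prod.fst h
  have h2 : X.toBlocks₂₂ = 0 := congrArg Prod.snd h
  ext (i | i) (j | j)
  · simpa [rowBlock, colBlock] using h1
  · simp [rowBlock, colBlock]
  · simp [rowBlock, colBlock]
  · simpa [rowBlock, colBlock, Matrix.toBlocks₂₂] using congrFun (congrFun h2 i) j

/-- A kernel element `x` has `θ x` purely off-diagonal. As `φ` varies over row (or column) blocks,
the block diagonal part of the commutator with `θ x` fills a space of dimension `card ι`, too large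
for the present range; some `φ` therefore raises the rank. -/
theorem exists_finrank_range_lt_of_not_injective
    {θ : V →ₗ[K] Matrix (Unit ⊕ ι) (Unit ⊕ ι) K} (hθ : Function.Injective θ)
    (hV : Module.finrank K V ≤ Fintype.card ι)
    (h : ¬ Function.Injective (blockDiagPart K ι ∘ₗ θ)) :
    ∃ P Q : Matrix (Unit ⊕ ι) (Unit ⊕ ι) K, P * Q = 1 ∧
      Module.finrank K (LinearMap.range (blockDiagPart K ι ∘ₗ θ)) <
        Module.finrank K (LinearMap.range (blockDiagPart K ι ∘ₗ mulLeftRight P Q θ)) := by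
  rw [injective_iff_map_eq_zero] at h
  push Not at h
  obtain ⟨x, hx, hx0⟩ := h
  have hX := eq_rowBlock_add_colBlock hx
  set r : ι → K := fun j => θ x (Sum.inl ()) (Sum.inr j)
  set c : ι → K := fun i => θ x (Sum.inr i) (Sum.inl ())
  -- The nonzero kernel makes the bound on `finrank K V` strict for the rank.
  have hlt : Module.finrank K (LinearMap.range (blockDiagPart K ι ∘ₗ θ)) < Fintype.card ι := by
    refine lt_of_lt_of_le ?_ hV
    have h1 := LinearMap.finrank_range_add_finrank_ker (blockDiagPart K ι ∘ₗ θ)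
    have h2 : 0 < Module.finrank K (LinearMap.ker (blockDiagPart K ι ∘ₗ θ)) :=
      Module.finrank_pos_iff_exists_ne_zero.mpr ⟨⟨x, hx⟩, fun h => hx0 (congrArg Subtype.val h)⟩
    omega
  have key : ∀ E : (ι → K) →ₗ[K] Matrix (Unit ⊕ ι) (Unit ⊕ ι) K,
      (∀ φ, blockDiagPart K ι (E φ * θ x - θ x * E φ) = 0 → φ = 0) →
      ∃ φ, blockDiagPart K ι (E φ * θ x - θ x * E φ) ∉
        LinearMap.range (blockDiagPart K ι ∘ₗ θ) := by
    intro E hE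
    by_contra! hall
    let ψ : (ι → K) →ₗ[K] K × Matrix ι ι K :=
      blockDiagPart K ι ∘ₗ (LinearMap.mulRight K (θ x) - LinearMap.mulLeft K (θ x)) ∘ₗ E
    have hψ : Function.Injective ψ := by
      rw [injective_iff_map_eq_zero]
      exact fun φ hφ => hE φ hφ
    have h1 : LinearMap.range ψ ≤ LinearMap.range (blockDiagPart K ι ∘ₗ θ) := by
      rintro _ ⟨φ, rfl⟩
      exact hall φ
    have h2 := Submodule.finrank_mono h1
    rw [LinearMap.finrank_range_of_inj hψ, Module.finrank_fintype_fun_eq_card] at h2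
    omega
  by_cases hc : c = 0
  · have hr : r ≠ 0 := by
      rintro hr
      rw [hc, hr, map_zero, map_zero, add_zero, map_eq_zero_iff θ hθ] at hX
      exact hx0 hX
    obtain ⟨j, hj⟩ := Function.ne_iff.mp hr
    obtain ⟨φ, hφ⟩ := key (colBlock K ι) fun φ hφ => by
      have h2 := congrArg Prod.snd hφ
      rw [hX] at h2
      ext i
      have := congrFun (congrFun h2 i) j
      simp only [Pi.zero_apply, ne_eq] at hj
      simpa [rowBlock, colBlock, Matrix.fromBlocks_multiply, Matrix.mul_add,
        Matrix.add_mul, Matrix.mul_apply, hj, sub_eq_add_neg, Matrix.fromBlocks_neg,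
        Matrix.fromBlocks_add, hc] using this
    refine exists_finrank_range_lt_of_commutator (colBlock_mul_self φ) hx ?_ hφ
    rw [hX]
    simp [rowBlock, colBlock, Matrix.fromBlocks_multiply, Matrix.mul_add]
  · obtain ⟨j, hj⟩ := Function.ne_iff.mp hc
    obtain ⟨φ, hφ⟩ := key (rowBlock K ι) fun φ hφ => by
      have h2 := congrArg Prod.snd hφ
      rw [hX] at h2
      ext i
      have := congrFun (congrFun h2 j) i
      simp only [Pi.zero_apply, ne_eq] at hj
      simpa [rowBlock, colBlock, Matrix.fromBlocks_multiply, Matrix.mul_add,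
        Matrix.add_mul, Matrix.mul_apply, hj, sub_eq_add_neg, Matrix.fromBlocks_neg,
        Matrix.fromBlocks_add] using this
    refine exists_finrank_range_lt_of_commutator (rowBlock_mul_self φ) hx ?_ hφ
    rw [hX]
    simp [rowBlock, colBlock, Matrix.fromBlocks_multiply, Matrix.mul_add]

/-- The rank cannot exceed `finrank K V`, so it cannot be raised indefinitely. -/
theorem exists_mulLeftRight_blockDiagPart_injective
    {θ : V →ₗ[K] Matrix (Unit ⊕ ι) (Unit ⊕ ι) K} (hθ : Function.Injective θ)
    (hV : Module.finrank K V ≤ Fintype.card ι) :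
    ∃ P Q : Matrix (Unit ⊕ ι) (Unit ⊕ ι) K, P * Q = 1 ∧
      Function.Injective (blockDiagPart K ι ∘ₗ mulLeftRight P Q θ) := by
  by_contra! hno
  have key : ∀ k : ℕ, ∃ P Q : Matrix (Unit ⊕ ι) (Unit ⊕ ι) K, P * Q = 1 ∧
      k ≤ Module.finrank K (LinearMap.range (blockDiagPart K ι ∘ₗ mulLeftRight P Q θ)) := by
    intro k
    induction k with
    | zero => exact ⟨1, 1, one_mul _, Nat.zero_le _⟩
    | succ k ih =>
      obtain ⟨P, Q, hPQ, hk⟩ := ih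
      obtain ⟨P', Q', hPQ', hk'⟩ := exists_finrank_range_lt_of_not_injective
        (mulLeftRight_injective hPQ hθ) hV (hno P Q hPQ)
      rw [mulLeftRight_mulLeftRight] at hk'
      refine ⟨P' * P, Q * Q', ?_, by omega⟩
      calc P' * P * (Q * Q') = P' * (P * Q) * Q' := by noncomm_ring
        _ = 1 := by rw [hPQ, mul_one, hPQ']
  obtain ⟨P, Q, -, h⟩ := key (Module.finrank K V + 1)
  have := LinearMap.finrank_range_le (blockDiagPart K ι ∘ₗ mulLeftRight P Q θ)
  omega

/-- For `E` a unit row or column block, the commutator puts the chosen off-diagonal entry, up to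
sign, into the corner, and the quadratic term contributes nothing there. -/
theorem exists_corner_ne_zero_of_offDiag_ne_zero
    {θ : V →ₗ[K] Matrix (Unit ⊕ ι) (Unit ⊕ ι) K}
    (h : Function.Injective (blockDiagPart K ι ∘ₗ θ)) {v : V}
    (hv : θ v (Sum.inl ()) (Sum.inl ()) = 0)
    (hne : (∃ i, θ v (Sum.inr i) (Sum.inl ()) ≠ 0) ∨ ∃ j, θ v (Sum.inl ()) (Sum.inr j) ≠ 0) :
    ∃ P Q : Matrix (Unit ⊕ ι) (Unit ⊕ ι) K, P * Q = 1 ∧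
      Function.Injective (blockDiagPart K ι ∘ₗ mulLeftRight P Q θ) ∧
      mulLeftRight P Q θ v (Sum.inl ()) (Sum.inl ()) ≠ 0 := by
  obtain ⟨E, hE, h1, h2⟩ : ∃ E : Matrix (Unit ⊕ ι) (Unit ⊕ ι) K, E * E = 0 ∧
      (E * θ v - θ v * E) (Sum.inl ()) (Sum.inl ()) ≠ 0 ∧
      (E * θ v * E) (Sum.inl ()) (Sum.inl ()) = 0 := by
    rcases hne with ⟨i, hi⟩ | ⟨i, hi⟩
    · refine ⟨rowBlock K ι (Pi.single i 1), rowBlock_mul_self _, ?_, ?_⟩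
      · simpa [rowBlock, Matrix.mul_apply, Pi.single_apply] using hi
      · simp [rowBlock, Matrix.mul_apply]
    · refine ⟨colBlock K ι (Pi.single i 1), colBlock_mul_self _, ?_, ?_⟩
      · simpa [colBlock, Matrix.mul_apply, Pi.single_apply] using hi
      · simp [colBlock, Matrix.mul_apply]
  obtain ⟨t, ht, hi⟩ := exists_blockDiagPart_injective_perturbation E h
  refine ⟨_, _, one_add_mul_one_sub hE t, hi, ?_⟩
  rw [mulLeftRight_one_add]
  have h1' := mul_ne_zero ht h1
  simpa [hv, h2] using h1'

theorem exists_corner_ne_zero [Nontrivial V]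
    {θ : V →ₗ[K] Matrix (Unit ⊕ ι) (Unit ⊕ ι) K}
    (h : Function.Injective (blockDiagPart K ι ∘ₗ θ)) :
    ∃ P Q : Matrix (Unit ⊕ ι) (Unit ⊕ ι) K, P * Q = 1 ∧
      Function.Injective (blockDiagPart K ι ∘ₗ mulLeftRight P Q θ) ∧
      ∃ v, mulLeftRight P Q θ v (Sum.inl ()) (Sum.inl ()) ≠ 0 := by
  obtain ⟨v, hv⟩ := exists_ne (0 : V)
  by_cases h0 : θ v (Sum.inl ()) (Sum.inl ()) ≠ 0
  · exact ⟨1, 1, one_mul _, by simpa [mulLeftRight] using h, v, by simpa using h0⟩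
  by_cases hne : (∃ i, θ v (Sum.inr i) (Sum.inl ()) ≠ 0) ∨ ∃ j, θ v (Sum.inl ()) (Sum.inr j) ≠ 0
  · obtain ⟨P, Q, h1, h2, h3⟩ := exists_corner_ne_zero_of_offDiag_ne_zero h (not_not.mp h0) hne
    exact ⟨P, Q, h1, h2, v, h3⟩
  push Not at h0 hne
  have hB : (θ v).toBlocks₂₂ ≠ 0 := fun hB =>
    hv (h (by rw [map_zero]; exact Prod.ext h0 hB))
  obtain ⟨i, j, hij⟩ : ∃ i j, θ v (Sum.inr i) (Sum.inr j) ≠ 0 := by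
    by_contra! hz
    exact hB (Matrix.ext hz)
  -- Here `θ v` lives only in the lower block. A first conjugation copies a multiple of its row `i`
  -- into the row of the corner, which reduces to the off-diagonal case.
  obtain ⟨t, ht, hi⟩ := exists_blockDiagPart_injective_perturbation
    (rowBlock K ι (Pi.single i 1)) h
  have hg := one_add_mul_one_sub (rowBlock_mul_self (K := K) (Pi.single i 1)) t
  obtain ⟨P, Q, h1, h2, h3⟩ := exists_corner_ne_zero_of_offDiag_ne_zero (v := v) hi
    (by
      rw [mulLeftRight_one_add]
      simp [rowBlock, Matrix.mul_apply, h0, hne])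
    (Or.inr ⟨j, by
      rw [mulLeftRight_one_add]
      simp [rowBlock, Matrix.mul_apply, hne, h0, hij, ht, Pi.single_apply]⟩)
  rw [mulLeftRight_mulLeftRight] at h2 h3
  refine ⟨_, _, ?_, h2, v, h3⟩
  calc _ = P * ((1 + t • rowBlock K ι (Pi.single i 1)) * (1 - t • rowBlock K ι (Pi.single i 1)))
        * Q := by noncomm_ring
    _ = 1 := by rw [hg, mul_one, h1]

end Block

/-! ### A conjugation that makes the diagonal injective. -/

/-- Induction on the size. After conjugation the pair (corner, lower block) is injective and the
corner is not identically zero, so its kernel has smaller dimension. The lower block is injective on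
that kernel, and conjugating it by the inductive `P`, `Q` leaves the corner untouched. -/
theorem exists_diag_injective {K : Type*} [Field K] [Infinite K] (m : ℕ) :
    ∀ {V : Type*} [AddCommGroup V] [Module K V] [FiniteDimensional K V]
      (_ : Module.finrank K V ≤ m) (θ : V →ₗ[K] Matrix (Fin (m + 1)) (Fin (m + 1)) K)
      (_ : Function.Injective θ),
      ∃ P Q : Matrix (Fin (m + 1)) (Fin (m + 1)) K, P * Q = 1 ∧
        ∀ v, (∀ i, (P * θ v * Q) i i = 0) → v = 0 := by
  induction m with
  | zero =>
    intro V _ _ _ hV θ hθ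
    have := Module.finrank_zero_iff.mp (Nat.le_zero.mp hV)
    exact ⟨1, 1, one_mul _, fun v _ => Subsingleton.elim _ _⟩
  | succ m ih =>
    intro V _ _ _ hV θ hθ
    cases subsingleton_or_nontrivial V
    · exact ⟨1, 1, one_mul _, fun v _ => Subsingleton.elim _ _⟩
    let e : Fin (m + 1 + 1) ≃ Unit ⊕ Fin (m + 1) := Fintype.equivOfCardEq (by simp [add_comm])
    let θ₁ := (Matrix.reindexLinearEquiv K K e e).toLinearMap ∘ₗ θ
    have hθ₁ : Function.Injective θ₁ := (Matrix.reindexLinearEquiv K K e e).injective.comp hθ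
    obtain ⟨P₁, Q₁, h₁, hi₁⟩ := exists_mulLeftRight_blockDiagPart_injective hθ₁ (by simpa using hV)
    obtain ⟨P₂, Q₂, h₂, hi₂, v₀, hv₀⟩ := exists_corner_ne_zero hi₁
    rw [mulLeftRight_mulLeftRight] at hi₂ hv₀
    have h₃ : (P₂ * P₁) * (Q₁ * Q₂) = 1 := by
      calc _ = P₂ * (P₁ * Q₁) * Q₂ := by noncomm_ring
        _ = 1 := by rw [h₁, mul_one, h₂]
    set P₃ := P₂ * P₁
    set Q₃ := Q₁ * Q₂
    let corner : V →ₗ[K] K := LinearMap.fst K _ _ ∘ₗ blockDiagPart K (Fin (m + 1)) ∘ₗ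
      mulLeftRight P₃ Q₃ θ₁
    let rest : V →ₗ[K] Matrix (Fin (m + 1)) (Fin (m + 1)) K := LinearMap.snd K _ _ ∘ₗ
      blockDiagPart K (Fin (m + 1)) ∘ₗ mulLeftRight P₃ Q₃ θ₁
    have hlt : Module.finrank K (LinearMap.ker corner) < Module.finrank K V := by
      refine Submodule.finrank_lt ?_
      intro htop
      rw [LinearMap.ker_eq_top] at htop
      exact hv₀ (LinearMap.congr_fun htop v₀)
    obtain ⟨P, Q, hPQ, hd⟩ := ih (by omega) (rest ∘ₗ (LinearMap.ker corner).subtype) (by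
      rw [injective_iff_map_eq_zero]
      rintro ⟨v, hv⟩ hrest
      refine Subtype.ext (hi₂ (Eq.trans ?_ (map_zero _).symm))
      exact Prod.ext hv hrest)
    let P₄ : Matrix (Unit ⊕ Fin (m + 1)) (Unit ⊕ Fin (m + 1)) K := Matrix.fromBlocks 1 0 0 P
    let Q₄ : Matrix (Unit ⊕ Fin (m + 1)) (Unit ⊕ Fin (m + 1)) K := Matrix.fromBlocks 1 0 0 Q
    have h₄ : P₄ * Q₄ = 1 := by
      simp [P₄, Q₄, Matrix.fromBlocks_multiply, hPQ, Matrix.fromBlocks_one]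
    refine ⟨(P₄ * P₃).submatrix e e, (Q₃ * Q₄).submatrix e e, ?_, fun v hv => ?_⟩
    · rw [Matrix.submatrix_mul_equiv]
      have : P₄ * P₃ * (Q₃ * Q₄) = 1 := by
        calc _ = P₄ * (P₃ * Q₃) * Q₄ := by noncomm_ring
          _ = 1 := by rw [h₃, mul_one, h₄]
      rw [this, Matrix.submatrix_one_equiv]
    · have hθe : θ v = (θ₁ v).submatrix e e := by
        ext i j
        simp [θ₁]
      have hX : ∀ i, (P₄ * (P₃ * θ₁ v * Q₃) * Q₄) i i = 0 := fun i => by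
        have := hv (e.symm i)
        rw [hθe, Matrix.submatrix_mul_equiv, Matrix.submatrix_mul_equiv] at this
        simpa [Matrix.mul_assoc] using this
      rw [← Matrix.fromBlocks_toBlocks (P₃ * θ₁ v * Q₃)] at hX
      simp only [P₄, Q₄, Matrix.fromBlocks_multiply] at hX
      have hcorner : corner v = 0 := by
        simpa [corner, Matrix.toBlocks₁₁] using hX (Sum.inl ())
      have := hd ⟨v, hcorner⟩ fun i => by simpa [rest] using hX (Sum.inr i)
      exact congrArg Subtype.val this

/-! ### The Jacobian criterion. -/

theorem derivation_aeval {k A M ι : Type*} [CommRing k] [CommRing A] [Algebra k A]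
    [AddCommGroup M] [Module A M] [Module k M] [Fintype ι] (D : Derivation k A M) (a : ι → A)
    (F : MvPolynomial ι k) :
    D (MvPolynomial.aeval a F) =
      ∑ j, MvPolynomial.aeval a (MvPolynomial.pderiv j F) • D (a j) := by
  classical
  induction F using MvPolynomial.induction_on with
  | C c => simp
  | add p q hp hq => simp [hp, hq, add_smul, Finset.sum_add_distrib]
  | mul_X p i hp =>
    simp only [map_mul, MvPolynomial.aeval_X, Derivation.leibniz, hp, smul_eq_mul, map_add,
      MvPolynomial.pderiv_X, add_smul, Finset.sum_add_distrib, Finset.smul_sum, smul_smul]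
    congr 1
    rw [Finset.sum_eq_single i]
    · simp
    · intro j _ hj
      simp [hj.symm]
    · simp

theorem totalDegree_pderiv_lt {k ι : Type*} [CommRing k] (i : ι) (F : MvPolynomial ι k)
    (h : MvPolynomial.pderiv i F ≠ 0) :
    (MvPolynomial.pderiv i F).totalDegree < F.totalDegree := by
  obtain ⟨m, hm, hdeg⟩ := Finset.exists_mem_eq_sup (MvPolynomial.pderiv i F).support
    (MvPolynomial.support_nonempty.mpr h) (fun s => s.sum fun _ e => e)
  rw [MvPolynomial.totalDegree, hdeg]
  have hm' : m + Finsupp.single i 1 ∈ F.support := by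
    rw [MvPolynomial.mem_support_iff, MvPolynomial.coeff_pderiv] at hm
    rw [MvPolynomial.mem_support_iff]
    exact left_ne_zero_of_mul hm
  have h1 := MvPolynomial.le_totalDegree hm'
  rw [Finsupp.sum_add_index' (by simp) (by simp), Finsupp.sum_single_index rfl] at h1
  omega

/-- The Jacobian criterion for algebraic independence over a perfect field. -/
theorem algebraicIndependent_of_det_derivation_ne_zero {k A ι : Type*} [Field k] [PerfectField k]
    [CommRing A] [IsDomain A] [Algebra k A] [Fintype ι] [DecidableEq ι] (a : ι → A)
    (D : ι → Derivation k A A) (hdet : (Matrix.of fun i j => D i (a j)).det ≠ 0) :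
    AlgebraicIndependent k a := by
  by_contra hnot
  obtain ⟨F, ⟨hF0, hFa⟩, hFmin⟩ : ∃ F ∈ {F : MvPolynomial ι k | F ≠ 0 ∧ F.aeval a = 0},
      ∀ G : MvPolynomial ι k, G ≠ 0 → G.aeval a = 0 → F.totalDegree ≤ G.totalDegree := by
    have hne : {F : MvPolynomial ι k | F ≠ 0 ∧ F.aeval a = 0}.Nonempty := by
      rw [algebraicIndependent_iff] at hnot
      push Not at hnot
      obtain ⟨F, h1, h2⟩ := hnot
      exact ⟨F, h2, h1⟩
    obtain ⟨F, hF, hmin⟩ := exists_minimalFor_of_wellFoundedLT (· ∈ _) MvPolynomial.totalDegree hne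
    refine ⟨F, hF, fun G h₁ h₂ => ?_⟩
    exact (le_total _ _).elim id fun h => hmin ⟨h₁, h₂⟩ h
  -- Applying `D i` to the relation and using the invertible Jacobian, every partial derivative of
  -- `F` is again a relation, of smaller degree unless zero.
  have hpd : ∀ j, MvPolynomial.pderiv j F = 0 := by
    have hz : (fun j => MvPolynomial.aeval a (MvPolynomial.pderiv j F)) = 0 := by
      refine Matrix.eq_zero_of_mulVec_eq_zero hdet ?_
      ext i
      have := derivation_aeval (D i) a F
      rw [hFa, map_zero] at this
      simp only [Matrix.mulVec, dotProduct, Matrix.of_apply, Pi.zero_apply]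
      rw [this]
      exact Finset.sum_congr rfl fun j _ => mul_comm _ _
    intro j
    by_contra hj
    exact absurd (totalDegree_pderiv_lt j F hj) (not_lt.mpr (hFmin _ hj (congrFun hz j)))
  have hcast : ∀ σ ∈ F.support, ∀ i, (σ i : k) = 0 := by
    intro σ hσ i
    by_contra hne
    have hpos : σ i ≠ 0 := fun h => hne (by simp [h])
    have h1 := congrArg (MvPolynomial.coeff (σ - Finsupp.single i 1)) (hpd i)
    have h2 : σ - Finsupp.single i 1 + Finsupp.single i 1 = σ :=
      tsub_add_cancel_of_le (by simpa [Nat.one_le_iff_ne_zero] using hpos)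
    rw [MvPolynomial.coeff_pderiv, h2, MvPolynomial.coeff_zero] at h1
    rw [MvPolynomial.mem_support_iff] at hσ
    refine hne ?_
    have h3 := (mul_eq_zero.mp h1).resolve_left hσ
    have h4 : ((σ i - 1 : ℕ) : k) + 1 = (σ i : k) := by
      rw [← Nat.cast_succ, Nat.succ_eq_add_one, Nat.sub_add_cancel (Nat.one_le_iff_ne_zero.mpr hpos)]
    rw [← h4]
    simpa using h3
  let K := FractionRing A
  have hinj : Function.Injective (algebraMap A K) := IsFractionRing.injective A K
  have hK : ∀ G : MvPolynomial ι k, MvPolynomial.aeval (fun i => algebraMap A K (a i)) G =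
      algebraMap A K (MvPolynomial.aeval a G) := fun G => MvPolynomial.aeval_algebraMap_apply _ _ _
  -- In characteristic zero `F` is now constant. In characteristic `p` all its exponents are
  -- multiples of `p`, and over a perfect field a `p`-th root would be a relation of smaller degree.
  obtain _ | ⟨p, hp, hpk⟩ := CharP.exists' k
  · have hconst : F = MvPolynomial.C (MvPolynomial.coeff 0 F) := by
      ext σ
      rw [MvPolynomial.coeff_C]
      split_ifs with h
      · rw [h]
      · by_contra hσ
        refine h (Finsupp.ext fun i => ?_)
        have := hcast σ (MvPolynomial.mem_support_iff.mpr hσ) i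
        rw [Nat.cast_eq_zero] at this
        rw [this, Finsupp.zero_apply]
    rw [hconst, MvPolynomial.aeval_C, map_eq_zero_iff _ (algebraMap k A).injective] at hFa
    exact hF0 (by rw [hconst, hFa, map_zero])
  · have : CharP K p := .of_ringHom_of_ne_zero (algebraMap k K) p hp.out.ne_zero
    have : ExpChar k p := .prime hp.out
    obtain ⟨i, σ, hσ, hdvd⟩ :=
      MvPolynomial.exists_mem_support_not_dvd_of_forall_totalDegree_le (k := k) (K := K) p hp.out
        (fun s hs => by
          -- Frobenius is bijective on `k`, so taking `p`-th powers preserves linear independence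
          -- over `k`.
          refine hs.map_of_injective_injective (frobeniusEquiv k p).symm
            (frobenius K p).toAddMonoidHom (by simp) (fun x hx => ?_) fun r m => ?_
          · exact (map_eq_zero_iff (frobenius K p) (frobenius K p).injective).mp hx
          · change (((frobeniusEquiv k p).symm r) • m) ^ p = r • m ^ p
            rw [_root_.smul_pow]
            congr 1
            exact (frobeniusEquiv k p).apply_symm_apply r)
        (a := fun i => algebraMap A K (a i)) (F := F)
        (fun G hG hGa => hFmin G hG (hinj (by rw [← hK, hGa, map_zero]))) hF0
        (by rw [hK, hFa, map_zero])
    exact hdvd ((CharP.cast_eq_zero_iff k p _).mp (hcast σ hσ i))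

/-! ### Derivations dual to a separating transcendence basis. -/

open scoped IntermediateField.algebraAdjoinAdjoin in
/-- A finitely generated extension of a perfect field has a transcendence basis with dual
derivations. -/
theorem exists_transcendenceBasis_derivation (k L : Type*) [DecidableEq L] [Field k] [Field L] [Algebra k L]
    [PerfectField k] [Algebra.EssFiniteType k L] :
    ∃ s : Finset L, IsTranscendenceBasis k ((↑) : s → L) ∧
      ∃ D : s → Derivation k L L, ∀ i j : s, D i (j : L) = Pi.single (M := fun _ => L) i 1 j := by
  classical
  obtain ⟨s, hs, hsep⟩ := exists_isTranscendenceBasis_and_isSeparable_of_perfectField k L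
  refine ⟨s, hs, ?_⟩
  have hrange : Set.range ((↑) : s → L) = (s : Set L) := by simp
  let E := IntermediateField.adjoin k (s : Set L)
  let B := Algebra.adjoin k (s : Set L)
  let e : MvPolynomial s k ≃ₐ[k] B :=
    hs.1.aevalEquiv.trans (Subalgebra.equivOfEq _ _ (by rw [hrange]))
  have heX : ∀ j : s, ((e (MvPolynomial.X j) : B) : L) = j := fun j => by
    simp [e]
  have : Algebra.FormallyEtale B E := Algebra.FormallyEtale.of_isLocalization (nonZeroDivisors B)
  have : Algebra.FormallyEtale E L := Algebra.FormallyEtale.of_isSeparable E L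
  -- A localization followed by a separable algebraic extension is formally étale, so the
  -- differentials of `L` are the base change of those of the polynomial ring `B` and the partial
  -- derivatives extend to `L`.
  have : Algebra.FormallyEtale B L := Algebra.FormallyEtale.comp B E L
  let d : s → Derivation k B L := fun i => Derivation.mk'
    ((Algebra.linearMap B L).restrictScalars k ∘ₗ e.toLinearMap ∘ₗ
      (MvPolynomial.pderiv i : Derivation k _ _).toLinearMap ∘ₗ e.symm.toLinearMap) (by
      intro a b
      simp [Algebra.smul_def])
  let D : s → Derivation k L L := fun i =>
    (((d i).liftKaehlerDifferential.liftBaseChange L) ∘ₗ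
      (KaehlerDifferential.tensorKaehlerEquivOfFormallyEtale k B L).symm.toLinearMap).compDer
        (KaehlerDifferential.D k L)
  refine ⟨D, fun i j => ?_⟩
  have hj : (j : L) = algebraMap B L (e (MvPolynomial.X j)) := (heX j).symm
  rw [hj]
  change (d i).liftKaehlerDifferential.liftBaseChange L
    ((KaehlerDifferential.tensorKaehlerEquivOfFormallyEtale k B L).symm
      (KaehlerDifferential.D k L (algebraMap B L (e (MvPolynomial.X j))))) = _
  rw [KaehlerDifferential.tensorKaehlerEquivOfFormallyEtale_symm_D_algebraMap,
    LinearMap.liftBaseChange_tmul, Derivation.liftKaehlerDifferential_comp_D, one_smul]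
  change ((e (MvPolynomial.pderiv i (e.symm (e (MvPolynomial.X j)))) : B) : L) = _
  rw [AlgEquiv.symm_apply_apply, MvPolynomial.pderiv_X]
  by_cases h : i = j
  · subst h
    simp
  · simp [Ne.symm h]

/-! ### Coefficientwise derivations and Jacobi's formula. -/

/-- The derivation of a polynomial ring that acts on the coefficients. -/
def mvMapCoeffs {k L : Type*} (σ : Type*) [CommRing k] [CommRing L] [Algebra k L]
    (D : Derivation k L L) : Derivation k (MvPolynomial σ L) (MvPolynomial σ L) :=
  Derivation.mk' ((AddMonoidAlgebra.coeffLinearEquiv k).symm.toLinearMap ∘ₗ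
    Finsupp.mapRange.linearMap D.toLinearMap ∘ₗ
      (AddMonoidAlgebra.coeffLinearEquiv k).toLinearMap) (by
    classical
    intro f g
    have key : ∀ (h : MvPolynomial σ L) m, MvPolynomial.coeff m
        (((AddMonoidAlgebra.coeffLinearEquiv k).symm.toLinearMap ∘ₗ
          Finsupp.mapRange.linearMap D.toLinearMap ∘ₗ
            (AddMonoidAlgebra.coeffLinearEquiv k).toLinearMap) h) =
        D (MvPolynomial.coeff m h) := fun h m => rfl
    ext m
    simp only [key, MvPolynomial.coeff_add, smul_eq_mul, MvPolynomial.coeff_mul, map_sum,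
      Derivation.leibniz, Finset.sum_add_distrib]
    congr 1
    exact Finset.sum_equiv (Equiv.prodComm _ _) (by simp [add_comm]) fun _ _ => rfl)

theorem coeff_mvMapCoeffs {k L σ : Type*} [CommRing k] [CommRing L] [Algebra k L]
    (D : Derivation k L L) (f : MvPolynomial σ L) (m : σ →₀ ℕ) :
    MvPolynomial.coeff m (mvMapCoeffs σ D f) = D (MvPolynomial.coeff m f) := rfl

@[simp] theorem mvMapCoeffs_C {k L σ : Type*} [CommRing k] [CommRing L] [Algebra k L]
    (D : Derivation k L L) (x : L) :
    mvMapCoeffs σ D (MvPolynomial.C x) = MvPolynomial.C (D x) := by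
  classical
  ext m
  rw [coeff_mvMapCoeffs, MvPolynomial.coeff_C, MvPolynomial.coeff_C]
  split_ifs <;> simp

@[simp] theorem mvMapCoeffs_X {k L σ : Type*} [CommRing k] [CommRing L] [Algebra k L]
    (D : Derivation k L L) (i : σ) :
    mvMapCoeffs σ D (MvPolynomial.X i) = 0 := by
  classical
  ext m
  rw [coeff_mvMapCoeffs, MvPolynomial.coeff_X]
  split_ifs <;> simp

theorem derivation_prod {k A M ι : Type*} [CommRing k] [CommRing A] [Algebra k A]
    [AddCommGroup M] [Module A M] [Module k M] [DecidableEq ι] (D : Derivation k A M)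
    (s : Finset ι) (f : ι → A) :
    D (∏ i ∈ s, f i) = ∑ i ∈ s, (∏ j ∈ s.erase i, f j) • D (f i) := by
  induction s using Finset.induction_on with
  | empty => simp
  | insert a s ha ih =>
    rw [Finset.prod_insert ha, Derivation.leibniz, ih, Finset.sum_insert ha,
      Finset.erase_insert ha, add_comm, Finset.smul_sum]
    congr 1
    refine Finset.sum_congr rfl fun i hi => ?_
    have hne : a ≠ i := fun h => ha (h ▸ hi)
    rw [Finset.erase_insert_of_ne hne, Finset.prod_insert (fun h => ha (Finset.mem_of_mem_erase h)),
      mul_smul]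

/-- Jacobi's formula for a derivation. -/
theorem derivation_det {k A n : Type*} [CommRing k] [CommRing A] [Algebra k A] [Fintype n]
    [DecidableEq n] (D : Derivation k A A) (X : Matrix n n A) :
    D X.det = (X.adjugate * X.map D).trace := by
  have h1 : D X.det = ∑ i, (X.updateCol i fun j => D (X j i)).det := by
    simp only [Matrix.det_apply, Units.smul_def, map_sum, map_zsmul, derivation_prod,
      Finset.smul_sum]
    rw [Finset.sum_comm]
    refine Finset.sum_congr rfl fun i _ => Finset.sum_congr rfl fun σ _ => ?_
    congr 1
    rw [← Finset.mul_prod_erase Finset.univ _ (Finset.mem_univ i), smul_eq_mul, mul_comm]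
    congr 1
    · simp
    · refine Finset.prod_congr rfl fun j hj => ?_
      rw [Matrix.updateCol_ne (Finset.ne_of_mem_erase hj)]
  rw [h1, Matrix.trace]
  refine Finset.sum_congr rfl fun i _ => ?_
  rw [← Matrix.cramer_apply, Matrix.cramer_eq_adjugate_mulVec]
  rfl

theorem derivation_eq_zero_of_adjoin_eq_top {k L : Type*} [Field k] [Field L] [Algebra k L]
    {S : Set L} (hS : IntermediateField.adjoin k S = ⊤) (D : Derivation k L L)
    (h : ∀ x ∈ S, D x = 0) : D = 0 := by
  ext x
  have hx : x ∈ IntermediateField.adjoin k S := hS ▸ IntermediateField.mem_top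
  induction hx using IntermediateField.adjoin_induction with
  | mem x hx => exact h x hx
  | algebraMap x => simp
  | add x y _ _ hx hy => simpa using congrArg₂ (· + ·) hx hy
  | inv x _ hx =>
    have hx' : D x = 0 := hx
    simp [Derivation.leibniz_inv, hx']
  | mul x y _ _ hx hy =>
    have hx' : D x = 0 := hx
    have hy' : D y = 0 := hy
    simp [hx', hy']

/-! ### Differentiating the generic characteristic polynomial. -/

/-- The matrix `diag(t j - t i)` has a zero in place `j`, so its adjugate is supported at the entry
`(j, j)`, and the trace sees only that diagonal entry of `P * Y * Q`. -/
theorem trace_adjugate_conj_diagonal {L n : Type*} [CommRing L] [Fintype n] [DecidableEq n]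
    {P Q : Matrix n n L} (hPQ : P * Q = 1) (t : n → L) (Y : Matrix n n L) (j : n) :
    ((Matrix.scalar n (t j) - Q * Matrix.diagonal t * P).adjugate *
      (Q * Matrix.diagonal t * P * Y)).trace =
      (∏ i ∈ Finset.univ.erase j, (t j - t i)) * (t j * (P * Y * Q) j j) := by
  have hQP := mul_eq_one_comm.mp hPQ
  have h1 : Matrix.scalar n (t j) - Q * Matrix.diagonal t * P =
      Q * Matrix.diagonal (fun i => t j - t i) * P := by
    have : Matrix.diagonal (fun i => t j - t i) = Matrix.scalar n (t j) - Matrix.diagonal t := by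
      rw [Matrix.scalar_apply, Matrix.diagonal_sub]
    rw [this, mul_sub, sub_mul]
    congr 1
    rw [← (Matrix.scalar_commute (t j) (fun r => Commute.all _ _) Q).eq, mul_assoc, hQP, mul_one]
  have hP : P.adjugate = P.det • Q := by
    calc P.adjugate = P.adjugate * (P * Q) := by rw [hPQ, mul_one]
      _ = P.det • Q := by rw [← mul_assoc, Matrix.adjugate_mul, Matrix.smul_mul, one_mul]
  have hdet : P.det * Q.det = 1 := by rw [← Matrix.det_mul, hPQ, Matrix.det_one]
  have h2 : (Q * Matrix.diagonal (fun i => t j - t i) * P).adjugate *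
      (Q * Matrix.diagonal t * P * Y) =
      Q * (Matrix.diagonal (fun i => ∏ l ∈ Finset.univ.erase i, (t j - t l)) *
        Matrix.diagonal t * (P * Y)) := by
    rw [Matrix.adjugate_mul_distrib, Matrix.adjugate_mul_distrib, Matrix.adjugate_diagonal, hP]
    calc _ = P.det • (Q * (Matrix.diagonal (fun i => ∏ l ∈ Finset.univ.erase i, (t j - t l)) *
        (Q.adjugate * Q) * Matrix.diagonal t * (P * Y))) := by
          simp only [Matrix.smul_mul, Matrix.mul_assoc]
      _ = _ := by
        rw [Matrix.adjugate_mul, Matrix.mul_smul, mul_one, Matrix.smul_mul, Matrix.smul_mul,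
          Matrix.mul_smul, smul_smul, hdet, one_smul]
  rw [h1, h2, Matrix.trace_mul_comm, Matrix.diagonal_mul_diagonal, Matrix.mul_assoc, Matrix.trace]
  rw [Finset.sum_eq_single j]
  · rw [Matrix.diag_apply, Matrix.diagonal_mul, mul_assoc]
  · intro i _ hi
    rw [Matrix.diag_apply, Matrix.diagonal_mul,
      Finset.prod_eq_zero (Finset.mem_erase.mpr ⟨hi.symm, Finset.mem_univ j⟩) (sub_self _)]
    simp
  · simp

/-- The coefficients of the characteristic polynomial of `M Z` with indeterminate `M`. -/
def genericCharpolyCoeff {n : ℕ} {L : Type*} [CommRing L] (z : Matrix (Fin n) (Fin n) L) (k : ℕ) :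
    MvPolynomial (Fin n × Fin n) L :=
  (Matrix.mvPolynomialX (Fin n) (Fin n) L * z.map MvPolynomial.C).charpoly.coeff k

theorem genericCharpolyCoeff_zero {n : ℕ} {L : Type*} [CommRing L] (z : Matrix (Fin n) (Fin n) L) :
    genericCharpolyCoeff z 0 =
      (-1) ^ n * (Matrix.mvPolynomialX (Fin n) (Fin n) L).det * MvPolynomial.C z.det := by
  have h := Matrix.det_eq_sign_charpoly_coeff
    (Matrix.mvPolynomialX (Fin n) (Fin n) L * z.map MvPolynomial.C)
  have hC : (z.map MvPolynomial.C).det = (MvPolynomial.C z.det : MvPolynomial (Fin n × Fin n) L) :=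
    (RingHom.map_det MvPolynomial.C z).symm
  rw [Matrix.det_mul, hC, Fintype.card_fin] at h
  rw [mul_assoc, h, ← mul_assoc, ← mul_pow]
  simp [genericCharpolyCoeff]

theorem sum_smul_derivation_apply {k L ι : Type*} [CommRing k] [CommRing L] [Algebra k L]
    [Fintype ι] (D : ι → Derivation k L L) (a : ι → L) (x : L) :
    (∑ i, a i • D i) x = ∑ i, a i * D i x := by
  rw [← Derivation.coeFnAddMonoidHom_apply, map_sum, Finset.sum_apply]
  rfl

/-- Annihilation of the differentials of the coefficients of the generic characteristic
polynomial, read off at a conjugate of a diagonal matrix. -/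
theorem diag_conj_eq_zero_of_eval_coeff_eq_zero {k L : Type*} [Field k] [Field L] [Algebra k L]
    {n : ℕ} {z : Matrix (Fin n) (Fin n) L} (hz : z.det ≠ 0) {P Q : Matrix (Fin n) (Fin n) L}
    (hPQ : P * Q = 1) {t : Fin n → k} (ht : Function.Injective t) (ht0 : ∀ i, t i ≠ 0)
    (D : Derivation k L L)
    (h : ∀ l, MvPolynomial.eval
      (fun ij => (Q * Matrix.diagonal (fun i => algebraMap k L (t i)) * P * z⁻¹) ij.1 ij.2)
      (mvMapCoeffs _ D (genericCharpolyCoeff z l)) = 0) (j : Fin n) :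
    (P * (z⁻¹ * z.map D) * Q) j j = 0 := by
  set T : Fin n → L := fun i => algebraMap k L (t i)
  set M₀ := Q * Matrix.diagonal T * P * z⁻¹ with hM₀
  set ev : MvPolynomial (Fin n × Fin n) L →+* L := MvPolynomial.eval fun ij => M₀ ij.1 ij.2
  set M := Matrix.mvPolynomialX (Fin n) (Fin n) L
  set δ := mvMapCoeffs (Fin n × Fin n) D
  let τ : MvPolynomial (Fin n × Fin n) L := algebraMap k _ (t j)
  let N := Matrix.scalar (Fin n) τ - M * z.map MvPolynomial.C
  -- `N.det` is the characteristic polynomial at the constant `τ`, which `δ` kills; only the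
  -- derivatives of the coefficients remain.
  have h1 : ev (δ N.det) = 0 := by
    have : N.det = (M * z.map MvPolynomial.C).charpoly.eval τ := by
      rw [Matrix.eval_charpoly]
    rw [this, Polynomial.eval_eq_sum_range, map_sum, map_sum]
    refine Finset.sum_eq_zero fun l _ => ?_
    have hτ : δ (τ ^ l) = 0 := by
      rw [Derivation.leibniz_pow, Derivation.map_algebraMap, smul_zero, smul_zero]
    rw [Derivation.leibniz, hτ, smul_zero, zero_add, smul_eq_mul, map_mul]
    exact mul_eq_zero_of_right _ (h l)
  have hevM : ev.mapMatrix M = M₀ := by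
    ext a b
    simp [ev, M]
  have hevz : ev.mapMatrix (z.map MvPolynomial.C) = z := by
    ext a b
    simp [ev]
  have hzz : M₀ * z = Q * Matrix.diagonal T * P := by
    rw [hM₀, Matrix.mul_assoc, Matrix.nonsing_inv_mul _ (isUnit_iff_ne_zero.mpr hz), mul_one]
  have hevτ : ev τ = T j := by
    simp [ev, τ, T, MvPolynomial.algebraMap_apply]
  have hevN : ev.mapMatrix N = Matrix.scalar (Fin n) (T j) - Q * Matrix.diagonal T * P := by
    rw [map_sub, map_mul, hevM, hevz, hzz]
    congr 1
    ext a b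
    by_cases hab : a = b <;> simp [hab, hevτ]
  have hδN : N.map δ = -(M * (z.map D).map MvPolynomial.C) := by
    ext1 a b
    have hs : δ (Matrix.scalar (Fin n) τ a b) = 0 := by
      by_cases hab : a = b
      · rw [hab, Matrix.scalar_apply, Matrix.diagonal_apply_eq]
        exact δ.map_algebraMap _
      · simp [hab]
    simp only [N, Matrix.map_apply, Matrix.sub_apply, map_sub, hs, Matrix.mul_apply, map_sum,
      Derivation.leibniz, zero_sub, Matrix.neg_apply]
    congr 1
    refine Finset.sum_congr rfl fun l _ => ?_
    simp [M, δ]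
  have hevδN : ev.mapMatrix (N.map δ) = -(Q * Matrix.diagonal T * P * (z⁻¹ * z.map D)) := by
    rw [hδN, map_neg, map_mul, hevM]
    have : ev.mapMatrix ((z.map D).map MvPolynomial.C) = z.map D := by
      ext a b
      simp [ev]
    rw [this, hM₀]
    simp only [Matrix.mul_assoc]
  rw [derivation_det] at h1
  have h2 : ev (N.adjugate * N.map δ).trace = (ev.mapMatrix (N.adjugate * N.map δ)).trace := by
    simp only [Matrix.trace, map_sum]
    rfl
  rw [h2, map_mul, hevδN, RingHom.map_adjugate, hevN, mul_neg, Matrix.trace_neg, neg_eq_zero,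
    trace_adjugate_conj_diagonal hPQ, mul_eq_zero, mul_eq_zero] at h1
  have hTi : Function.Injective T := (algebraMap k L).injective.comp ht
  refine (h1.resolve_left ?_).resolve_left ?_
  · rw [← ne_eq, Finset.prod_ne_zero_iff]
    intro i hi
    rw [sub_ne_zero]
    exact fun he => Finset.ne_of_mem_erase hi (hTi he).symm
  · exact (_root_.map_ne_zero _).mpr (ht0 j)

/-- The Jacobian criterion applied to the derivations in the indeterminates and `m` coefficientwise
derivations from a transcendence basis. Only the block `J` matters, and it is tested at one
specialization of `M`. -/
theorem algebraicIndependent_genericCharpolyCoeff_of_det_mem {k L : Type*} [Field k] [Field L]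
    [Algebra k L] [PerfectField k] [Infinite k] [Algebra.EssFiniteType k L] {m : ℕ}
    {z : Matrix (Fin (m + 1)) (Fin (m + 1)) L} (hz : z.det ≠ 0)
    (hzk : z.det ∈ Set.range (algebraMap k L))
    (hgen : IntermediateField.adjoin k (Set.range fun ij : Fin (m + 1) × Fin (m + 1) =>
      z ij.1 ij.2) = ⊤)
    (hm : (m : Cardinal) ≤ Algebra.trdeg k L) :
    AlgebraicIndependent k (Sum.elim (fun ij => (MvPolynomial.X ij : MvPolynomial _ L))
      (fun l : Fin m => genericCharpolyCoeff z (l + 1))) := by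
  classical
  obtain ⟨s, hs, D, hD⟩ := exists_transcendenceBasis_derivation k L
  have hcard : m ≤ Fintype.card s := by
    rw [← hs.cardinalMk_eq_trdeg] at hm
    simpa using hm
  obtain ⟨f⟩ : Nonempty (Fin m ↪ s) := by
    rw [Function.Embedding.nonempty_iff_card_le]
    simpa using hcard
  let Dsum : (Fin m → L) → Derivation k L L := fun a => ∑ i, a i • D (f i)
  have hDsum : ∀ a j, Dsum a (f j : L) = a j := fun a j => by
    rw [sum_smul_derivation_apply, Finset.sum_eq_single j]
    · simp [hD]
    · intro i _ hi
      have : f j ≠ f i := fun h => hi (f.injective h).symm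
      simp [hD, this]
    · simp
  -- The logarithmic derivative of `z`; it is injective because the entries of `z` generate `L`.
  let θ : (Fin m → L) →ₗ[L] Matrix (Fin (m + 1)) (Fin (m + 1)) L :=
    { toFun := fun a => z⁻¹ * z.map (Dsum a)
      map_add' := fun a b => by
        rw [← mul_add]
        congr 1
        ext i j
        simp [Dsum, sum_smul_derivation_apply, add_mul, Finset.sum_add_distrib]
      map_smul' := fun c a => by
        rw [RingHom.id_apply, ← Matrix.mul_smul]
        congr 1
        ext i j
        simp [Dsum, sum_smul_derivation_apply, mul_assoc, Finset.mul_sum] }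
  have hθ : Function.Injective θ := by
    rw [injective_iff_map_eq_zero]
    intro a ha
    have h1 : z.map (Dsum a) = 0 := by
      have h2 : z * (z⁻¹ * z.map (Dsum a)) = 0 := by
        rw [show z⁻¹ * z.map (Dsum a) = 0 from ha, mul_zero]
      rwa [← Matrix.mul_assoc, Matrix.mul_nonsing_inv _ (isUnit_iff_ne_zero.mpr hz), one_mul] at h2
    have h3 : Dsum a = 0 := derivation_eq_zero_of_adjoin_eq_top hgen _ (by
      rintro _ ⟨ij, rfl⟩
      exact congrFun (congrFun h1 ij.1) ij.2)
    ext j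
    rw [← hDsum a j, h3]
    rfl
  have : Infinite L := Infinite.of_injective _ (algebraMap k L).injective
  obtain ⟨P, Q, hPQ, hdiag⟩ := exists_diag_injective m (by simp) θ hθ
  -- The eigenvalues lie in `k`, so derivations kill them; being distinct and nonzero lets their
  -- factors be cancelled after Jacobi's formula.
  obtain ⟨t, ht, ht0⟩ : ∃ t : Fin (m + 1) → k, Function.Injective t ∧ ∀ i, t i ≠ 0 := by
    have : Infinite ({0}ᶜ : Set k) := (Set.finite_singleton (0 : k)).infinite_compl.to_subtype
    let e := Infinite.natEmbedding ({0}ᶜ : Set k)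
    exact ⟨fun i => e i, Subtype.val_injective.comp (e.injective.comp Fin.val_injective),
      fun i => (e i).2⟩
  let M₀ := Q * Matrix.diagonal (fun i => algebraMap k L (t i)) * P * z⁻¹
  let ev : MvPolynomial (Fin (m + 1) × Fin (m + 1)) L →+* L :=
    MvPolynomial.eval fun ij => M₀ ij.1 ij.2
  let J : Matrix (Fin m) (Fin m) (MvPolynomial (Fin (m + 1) × Fin (m + 1)) L) :=
    Matrix.of fun i l => mvMapCoeffs _ (D (f i)) (genericCharpolyCoeff z (l + 1))
  have hJ : J.det ≠ 0 := by
    intro hJ0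
    have h1 : (ev.mapMatrix J).det = 0 := by rw [← RingHom.map_det, hJ0, map_zero]
    -- A left kernel vector is a combination `Dsum a` that kills, at `M₀`, the `m` intermediate
    -- coefficients. The constant one is killed because `z.det` comes from `k`, the leading one
    -- because it is 1.
    obtain ⟨a, ha0, ha⟩ := Matrix.exists_vecMul_eq_zero_iff.mpr h1
    refine ha0 (hdiag a fun j => ?_)
    refine diag_conj_eq_zero_of_eval_coeff_eq_zero hz hPQ ht ht0 (Dsum a) (fun l => ?_) j
    have hsum : ∀ F, mvMapCoeffs (Fin (m + 1) × Fin (m + 1)) (Dsum a) F =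
        ∑ i, MvPolynomial.C (a i) * mvMapCoeffs _ (D (f i)) F := fun F => by
      ext σ
      simp only [coeff_mvMapCoeffs, MvPolynomial.coeff_sum, MvPolynomial.coeff_C_mul]
      exact sum_smul_derivation_apply _ _ _
    have hnat := Matrix.charpoly_natDegree_eq_dim
      (Matrix.mvPolynomialX (Fin (m + 1)) (Fin (m + 1)) L * z.map MvPolynomial.C)
    rw [Fintype.card_fin] at hnat
    rcases l with _ | l
    · obtain ⟨y, hy⟩ := hzk
      have h2 : mvMapCoeffs _ (Dsum a)
          (Matrix.mvPolynomialX (Fin (m + 1)) (Fin (m + 1)) L).det = 0 := by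
        rw [derivation_det]
        have : (Matrix.mvPolynomialX (Fin (m + 1)) (Fin (m + 1)) L).map
            (mvMapCoeffs _ (Dsum a)) = 0 := by
          ext1 i j
          simp
        rw [this, mul_zero, Matrix.trace_zero]
      have h3 : mvMapCoeffs (Fin (m + 1) × Fin (m + 1)) (Dsum a)
          ((-1 : MvPolynomial (Fin (m + 1) × Fin (m + 1)) L) ^ (m + 1)) = 0 := by
        rw [Derivation.leibniz_pow, Derivation.map_neg, Derivation.map_one_eq_zero]
        simp
      rw [genericCharpolyCoeff_zero, Derivation.leibniz, Derivation.leibniz, h2, h3,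
        mvMapCoeffs_C, ← hy, Derivation.map_algebraMap]
      simp
    · rcases lt_trichotomy l m with hl | hl | hl
      · have := congrFun ha ⟨l, hl⟩
        rw [hsum, map_sum]
        simpa [Matrix.vecMul, dotProduct, J, ev, M₀] using this
      · have h2 : genericCharpolyCoeff z (l + 1) = 1 := by
          rw [hl]
          have := (Matrix.charpoly_monic
            (Matrix.mvPolynomialX (Fin (m + 1)) (Fin (m + 1)) L * z.map MvPolynomial.C))
          rwa [Polynomial.Monic, Polynomial.leadingCoeff, hnat] at this
        rw [h2, Derivation.map_one_eq_zero, map_zero]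
      · have h2 : genericCharpolyCoeff z (l + 1) = 0 :=
          Polynomial.coeff_eq_zero_of_natDegree_lt (by omega)
        rw [h2, map_zero, map_zero]
  refine algebraicIndependent_of_det_derivation_ne_zero _
    (Sum.elim (fun ij => (MvPolynomial.pderiv ij).restrictScalars k)
      (fun i => mvMapCoeffs _ (D (f i)))) ?_
  have hblock : (Matrix.of fun i j => (Sum.elim
      (fun ij => (MvPolynomial.pderiv ij : Derivation L (MvPolynomial _ L) _).restrictScalars k)
      (fun i => mvMapCoeffs _ (D (f i))) i) (Sum.elim
        (fun ij => (MvPolynomial.X ij : MvPolynomial (Fin (m + 1) × Fin (m + 1)) L))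
        (fun l : Fin m => genericCharpolyCoeff z (l + 1)) j)) =
      Matrix.fromBlocks 1 (Matrix.of fun ij (l : Fin m) => MvPolynomial.pderiv ij
        (genericCharpolyCoeff z ((l : ℕ) + 1))) 0 J := by
    ext1 (i | i) (j | j)
    · simp [MvPolynomial.pderiv_X, Matrix.one_apply, Pi.single_apply, eq_comm]
    · simp
    · simp
    · simp [J]
  rw [hblock, Matrix.det_fromBlocks_zero₂₁, Matrix.det_one, one_mul]
  exact hJ

/-! ### Absorbing the determinant into the base field. -/

theorem adjoin_adjoin_preimage_eq_top {F E : Type*} [Field F] [Field E] [Algebra F E] (S : Set E) :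
    IntermediateField.adjoin F (((↑) : IntermediateField.adjoin F S → E) ⁻¹' S) = ⊤ := by
  apply IntermediateField.lift_injective
  rw [IntermediateField.lift_adjoin, IntermediateField.lift_top, Set.image_preimage_eq_of_subset]
  intro x hx
  exact ⟨⟨x, IntermediateField.subset_adjoin F S hx⟩, rfl⟩

theorem trdeg_adjoin_simple_le_one {F E : Type*} [Field F] [Field E] [Algebra F E] (y : E) :
    Algebra.trdeg F (IntermediateField.adjoin F {y}) ≤ 1 := by
  let S : Set (IntermediateField.adjoin F {y}) := (↑) ⁻¹' ({y} : Set E)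
  have : Algebra.IsAlgebraic (Algebra.adjoin F S) (IntermediateField.adjoin F {y}) := by
    rw [← IntermediateField.isAlgebraic_adjoin_iff_top, adjoin_adjoin_preimage_eq_top,
      Algebra.isAlgebraic_iff_isIntegral]
    exact Algebra.isIntegral_of_surjective IntermediateField.topEquiv.surjective
  refine (Algebra.IsAlgebraic.trdeg_le_cardinalMk F S).trans ?_
  rw [Cardinal.mk_le_one_iff_set_subsingleton]
  intro a ha b hb
  exact Subtype.ext (ha.trans hb.symm)

theorem trdeg_eq_trdeg_of_isAlgebraic {E K L Ω : Type u} [Field E] [Field K] [Field L] [Field Ω]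
    [Algebra E K] [Algebra K L] [Algebra L Ω] [Algebra K Ω] [Algebra E Ω] [IsScalarTower E K Ω]
    [IsScalarTower K L Ω] [Algebra.IsAlgebraic E K] [Algebra.IsAlgebraic L Ω] :
    Algebra.trdeg E Ω = Algebra.trdeg K L := by
  rw [← trdeg_add_eq E K (A := Ω), ← trdeg_add_eq K L (A := Ω),
    trdeg_eq_zero (R := E),
    trdeg_eq_zero (R := L), add_zero, zero_add]

theorem genericCharpolyCoeff_map {n : ℕ} {R S : Type*} [CommRing R] [CommRing S] (f : R →+* S)
    (z : Matrix (Fin n) (Fin n) R) (l : ℕ) :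
    MvPolynomial.map f (genericCharpolyCoeff z l) = genericCharpolyCoeff (z.map f) l := by
  rw [genericCharpolyCoeff, genericCharpolyCoeff, ← Polynomial.coeff_map, ← Matrix.charpoly_map,
    Matrix.map_mul]
  congr 3
  · ext1 i j
    simp
  · ext1 i j
    simp

/-- The constant coefficient differs from `det z` by the nonzero factor `± det X`, which lies in the
algebra generated by the indeterminates, so the two can be exchanged. -/
theorem algebraicIndependent_genericCharpolyCoeff_of_transcendental {F L : Type*} [Field F]
    [Field L] [Algebra F L] {m : ℕ} {z : Matrix (Fin (m + 1)) (Fin (m + 1)) L}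
    (h : AlgebraicIndependent F (Sum.elim (fun _ : Unit => MvPolynomial.C z.det)
      (Sum.elim (fun ij => (MvPolynomial.X ij : MvPolynomial _ L))
        (fun l : Fin m => genericCharpolyCoeff z (l + 1))))) :
    AlgebraicIndependent F (Sum.elim (fun ij => (MvPolynomial.X ij : MvPolynomial _ L))
      (fun l : Fin (m + 1) => genericCharpolyCoeff z l)) := by
  set u := Sum.elim (fun ij => (MvPolynomial.X ij : MvPolynomial _ L))
    (fun l : Fin m => genericCharpolyCoeff z (l + 1))
  rw [AlgebraicIndependent.sumElim_iff, algebraicIndependent_unique_type_iff (ι := Unit)] at h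
  have h2 : Transcendental (Algebra.adjoin F (Set.range u)) (genericCharpolyCoeff z 0) := by
    intro halg
    refine h.2 ?_
    let A := Algebra.adjoin F (Set.range u)
    let X₀ : Matrix (Fin (m + 1)) (Fin (m + 1)) A :=
      Matrix.of fun i j => ⟨u (Sum.inl (i, j)), Algebra.subset_adjoin ⟨_, rfl⟩⟩
    have hX₀ : algebraMap A (MvPolynomial _ L) ((-1) ^ (m + 1) * X₀.det) =
        (-1) ^ (m + 1) * (Matrix.mvPolynomialX (Fin (m + 1)) (Fin (m + 1)) L).det := by
      rw [map_mul, RingHom.map_det, map_pow, map_neg, map_one]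
      rfl
    rw [genericCharpolyCoeff_zero, ← hX₀] at halg
    refine IsAlgebraic.of_mul ?_ (isAlgebraic_algebraMap ((-1) ^ (m + 1) * X₀.det)) halg
    rw [hX₀]
    exact mem_nonZeroDivisors_of_ne_zero (mul_ne_zero (pow_ne_zero _ (neg_ne_zero.mpr one_ne_zero))
      (Matrix.det_mvPolynomialX_ne_zero _ _))
  have h3 : AlgebraicIndependent F (Sum.elim (fun _ : Unit => genericCharpolyCoeff z 0) u) := by
    rw [AlgebraicIndependent.sumElim_iff, algebraicIndependent_unique_type_iff (ι := Unit)]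
    exact ⟨h.1, h2⟩
  let g : (Fin (m + 1) × Fin (m + 1)) ⊕ Fin (m + 1) →
      Unit ⊕ ((Fin (m + 1) × Fin (m + 1)) ⊕ Fin m) :=
    Sum.elim (fun ij => Sum.inr (Sum.inl ij))
      (Fin.cases (Sum.inl ()) fun l => Sum.inr (Sum.inr l))
  have hg : Function.Injective g := by
    rintro (a | a) (b | b) hab
    · simpa [g] using hab
    · induction b using Fin.cases <;> simp [g] at hab
    · induction a using Fin.cases <;> simp [g] at hab
    · induction a using Fin.cases <;> induction b using Fin.cases <;> simp [g] at hab ⊢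
      exact hab
  convert h3.comp g hg using 1
  ext1 (a | a)
  · rfl
  · induction a using Fin.cases <;> simp [g, u]

/-- Independence is split in two: `det z` over `F`, and the remaining family over a field `K`
containing `det z`. -/
theorem algebraicIndependent_genericCharpolyCoeff {F R : Type u} [Field F] [IsAlgClosed F]
    [CommRing R] [IsDomain R] [Algebra F R] {m : ℕ} {z : Matrix (Fin (m + 1)) (Fin (m + 1)) R}
    (hdet : z.det ∉ Set.range (algebraMap F R))
    (hgen : Algebra.adjoin F (Set.range fun ij : Fin (m + 1) × Fin (m + 1) => z ij.1 ij.2) = ⊤)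
    (hm : ((m + 1 : ℕ) : Cardinal) ≤ Algebra.trdeg F R) :
    AlgebraicIndependent F (Sum.elim (fun ij => (MvPolynomial.X ij : MvPolynomial _ R))
      (fun l : Fin (m + 1) => genericCharpolyCoeff z l)) := by
  let Ω := AlgebraicClosure (FractionRing R)
  have hRΩ : Function.Injective (algebraMap R Ω) := by
    rw [IsScalarTower.algebraMap_eq R (FractionRing R) Ω]
    exact (algebraMap (FractionRing R) Ω).injective.comp (IsFractionRing.injective R _)
  have : Algebra.IsAlgebraic R (FractionRing R) :=
    IsLocalization.isAlgebraic (FractionRing R) (nonZeroDivisors R)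
  have hRalg : Algebra.IsAlgebraic R Ω := Algebra.IsAlgebraic.trans R (FractionRing R) Ω
  let y : Ω := algebraMap R Ω z.det
  have hy : Transcendental F y := by
    rw [Transcendental, isAlgebraic_algebraMap_iff hRΩ]
    intro halg
    refine hdet ?_
    have hint : IsIntegral F z.det := halg.isIntegral
    exact minpoly.mem_range_of_degree_eq_one F z.det
      (IsAlgClosed.degree_eq_one_of_irreducible F (minpoly.irreducible hint))
  let E := IntermediateField.adjoin F {y}
  -- In positive characteristic `E = F(y)` is not perfect; its algebraic closure is, and it has the
  -- same transcendence degree over `F`.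
  let K := algebraicClosure E Ω
  have : IsAlgClosed K := IsAlgClosure.isAlgClosed E
  let S : Set Ω := Set.range fun ij : Fin (m + 1) × Fin (m + 1) => algebraMap R Ω (z ij.1 ij.2)
  let L := IntermediateField.adjoin K S
  have hρ : ∀ r : R, algebraMap R Ω r ∈ L := by
    intro r
    have hr : r ∈ Algebra.adjoin F (Set.range fun ij : Fin (m + 1) × Fin (m + 1) =>
      z ij.1 ij.2) := hgen ▸ Algebra.mem_top
    induction hr using Algebra.adjoin_induction with
    | mem x hx =>
      obtain ⟨ij, rfl⟩ := hx
      exact IntermediateField.subset_adjoin K S ⟨ij, rfl⟩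
    | algebraMap x =>
      rw [← IsScalarTower.algebraMap_apply F R Ω]
      exact L.algebraMap_mem (algebraMap F K x)
    | add a b _ _ ha hb => rw [map_add]; exact add_mem ha hb
    | mul a b _ _ ha hb => rw [map_mul]; exact mul_mem ha hb
  let ρ : R →+* L := (algebraMap R Ω).codRestrict L hρ
  let _ : Algebra R L := ρ.toAlgebra
  have : IsScalarTower R L Ω := IsScalarTower.of_algebraMap_eq fun _ => rfl
  let _ : Algebra F L := ((algebraMap K L).comp (algebraMap F K)).toAlgebra
  have : IsScalarTower F K L := IsScalarTower.of_algebraMap_eq fun _ => rfl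
  have hFL : ∀ x, algebraMap F L x = ρ (algebraMap F R x) := fun x =>
    Subtype.ext (IsScalarTower.algebraMap_apply F R Ω x)
  have hLalg : Algebra.IsAlgebraic L Ω := Algebra.IsAlgebraic.extendScalars (R := R) (S := L)
    (fun a b h => hRΩ (congrArg Subtype.val h))
  have : IsScalarTower F K Ω := IsScalarTower.of_algebraMap_eq fun _ => rfl
  -- Moving `y` into the base field costs at most one from the transcendence degree `m + 1`.
  have htr : (m : Cardinal) ≤ Algebra.trdeg K L := by
    have h1 := trdeg_add_eq F E (A := Ω)
    have h2 : Algebra.trdeg E Ω = Algebra.trdeg K L := trdeg_eq_trdeg_of_isAlgebraic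
    have h4 : Algebra.trdeg F R ≤ Algebra.trdeg F Ω :=
      trdeg_le_of_injective (IsScalarTower.toAlgHom F R Ω) hRΩ
    have h5 := trdeg_adjoin_simple_le_one (F := F) y
    rw [← Cardinal.add_one_le_add_one_iff, ← h2]
    calc (m : Cardinal) + 1 ≤ Algebra.trdeg F Ω := by exact_mod_cast hm.trans h4
      _ = Algebra.trdeg F E + Algebra.trdeg E Ω := h1.symm
      _ ≤ 1 + Algebra.trdeg E Ω := by gcongr
      _ = _ := add_comm _ _
  have : Algebra.EssFiniteType K L :=
    IntermediateField.essFiniteType_iff.mpr (IntermediateField.fg_adjoin_of_finite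
      (Set.finite_range _))
  have hyK : y ∈ K := K.algebraMap_mem (⟨y, IntermediateField.mem_adjoin_simple_self F y⟩ : E)
  have hdetz : (z.map ρ).det = ρ z.det := (RingHom.map_det ρ z).symm
  have hdetK : (z.map ρ).det = algebraMap K L ⟨y, hyK⟩ := by
    rw [hdetz]
    rfl
  have hz0 : (z.map ρ).det ≠ 0 := by
    rw [hdetK, _root_.map_ne_zero]
    intro h0
    refine hy ?_
    have : y = 0 := congrArg Subtype.val h0
    rw [this]
    exact isAlgebraic_zero
  have : Infinite K := IsAlgClosed.instInfinite
  have hAI := algebraicIndependent_genericCharpolyCoeff_of_det_mem (k := K) hz0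
    ⟨_, hdetK.symm⟩ (by
      rw [← adjoin_adjoin_preimage_eq_top]
      congr 1
      ext x
      constructor
      · rintro ⟨ij, rfl⟩
        exact ⟨ij, rfl⟩
      · rintro ⟨ij, h⟩
        exact ⟨ij, Subtype.ext h⟩) htr
  have hyAI : AlgebraicIndependent F (fun _ : Unit => (⟨y, hyK⟩ : K)) := by
    rw [algebraicIndependent_unique_type_iff]
    intro h
    exact hy (h.algebraMap (A := Ω))
  have hC : MvPolynomial.C (z.map ρ).det =
      algebraMap K (MvPolynomial (Fin (m + 1) × Fin (m + 1)) L) ⟨y, hyK⟩ := by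
    rw [hdetK]
    rfl
  have hAI₂ : AlgebraicIndependent F (Sum.elim
      (fun _ : Unit => (MvPolynomial.C (z.map ρ).det : MvPolynomial (Fin (m + 1) × Fin (m + 1)) L))
      (Sum.elim (fun ij => (MvPolynomial.X ij : MvPolynomial _ L))
        (fun l : Fin m => genericCharpolyCoeff (z.map ρ) (l + 1)))) := by
    convert (hyAI.sumElim_comp hAI).comp Sum.swap Sum.swap_leftInverse.injective using 1
    ext1 (a | a)
    · exact hC
    · simp
  refine AlgebraicIndependent.of_ringHom_of_comp_eq (S := F) (RingHom.id F) (MvPolynomial.map ρ)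
    ?_ Function.injective_id ?_
  · convert algebraicIndependent_genericCharpolyCoeff_of_transcendental hAI₂ using 1
    ext1 (a | a)
    · simp
    · simp [genericCharpolyCoeff_map]
  · refine RingHom.ext fun x => ?_
    change MvPolynomial.C (algebraMap F L x) = MvPolynomial.map ρ (MvPolynomial.C (algebraMap F R x))
    rw [MvPolynomial.map_C, hFL]

/-! ### Krull dimension and transcendence degree. -/

/-- An integral extension has the same Krull dimension. -/
theorem ringKrullDim_eq_of_isIntegral {A B : Type*} [CommRing A] [CommRing B] [Algebra A B]
    [Algebra.IsIntegral A B] (h : Function.Injective (algebraMap A B)) :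
    ringKrullDim A = ringKrullDim B := by
  apply le_antisymm
  · refine iSup_le fun l => ?_
    obtain ⟨Q, -, hQ, hQc⟩ := Ideal.exists_ideal_over_prime_of_isIntegral
      (RelSeries.head l).asIdeal (⊥ : Ideal B)
      (by rw [← RingHom.ker_eq_comap_bot, (RingHom.injective_iff_ker_eq_bot _).1 h]; exact bot_le)
    have : Q.LiesOver (RelSeries.head l).asIdeal := ⟨hQc.symm⟩
    obtain ⟨L, hL, -⟩ := Ideal.exists_ltSeries_of_hasGoingUp l Q
    rw [← hL]
    exact le_iSup (fun l : LTSeries (PrimeSpectrum B) => (l.length : WithBot ℕ∞)) L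
  · refine Order.krullDim_le_of_strictMono (PrimeSpectrum.comap (algebraMap A B)) ?_
    intro P Q hPQ
    exact Ideal.IsIntegral.comap_lt_comap (A := B) (R := A) (I := P.asIdeal) (J := Q.asIdeal) hPQ

/-- By Noether normalization both invariants equal the number of variables of a polynomial ring over
which `R` is integral. -/
theorem natCast_le_ringKrullDim_iff {F R : Type u} [Field F] [CommRing R] [IsDomain R]
    [Algebra F R] [Algebra.FiniteType F R] (n : ℕ) :
    (n : WithBot ℕ∞) ≤ ringKrullDim R ↔ (n : Cardinal) ≤ Algebra.trdeg F R := by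
  obtain ⟨s, g, hg, hint⟩ := exists_integral_inj_algHom_of_fg F R
  algebraize [g.toRingHom]
  have hg' : Function.Injective (algebraMap (MvPolynomial (Fin s) F) R) := hg
  have : FaithfulSMul (MvPolynomial (Fin s) F) R :=
    (faithfulSMul_iff_algebraMap_injective _ _).2 hg'
  have : IsScalarTower F (MvPolynomial (Fin s) F) R :=
    IsScalarTower.of_algebraMap_eq fun x => (g.commutes x).symm
  have : Algebra.IsIntegral (MvPolynomial (Fin s) F) R := ⟨hint⟩
  have h1 : ringKrullDim R = s := by
    rw [← ringKrullDim_eq_of_isIntegral hg']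
    simp [MvPolynomial.ringKrullDim_of_isNoetherianRing]
  have h2 : Algebra.trdeg F R = s := by
    rw [← trdeg_add_eq F (MvPolynomial (Fin s) F) (A := R),
      trdeg_eq_zero (R := MvPolynomial (Fin s) F)]
    simp [MvPolynomial.trdeg_of_isDomain]
  rw [h1, h2]
  norm_cast

/-! ### Rational points and Chevalley's theorem. -/

/-- A nonzero finitely generated algebra over an algebraically closed field has
a rational point. -/
theorem nonempty_algHom_of_finiteType {F B : Type*} [Field F] [IsAlgClosed F] [CommRing B]
    [Nontrivial B] [Algebra F B] [Algebra.FiniteType F B] : Nonempty (B →ₐ[F] F) := by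
  obtain ⟨m, hm⟩ := Ideal.exists_maximal B
  let := Ideal.Quotient.field m
  have := finite_of_finite_type_of_isJacobsonRing F (B ⧸ m)
  exact ⟨(IsAlgClosed.lift : (B ⧸ m) →ₐ[F] F).comp (Ideal.Quotient.mkₐ F m)⟩

/-- **Chevalley**: a dominant morphism from an affine variety to an affine space over an
algebraically closed field has an image that contains a nonempty basic open set. -/
theorem exists_ne_zero_forall_lift {F B σ : Type*} [Field F] [IsAlgClosed F] [CommRing B]
    [Nontrivial B] [Algebra F B] [Algebra.FiniteType F B] [Finite σ]
    (φ : MvPolynomial σ F →ₐ[F] B) (hφ : Function.Injective φ) :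
    ∃ f : MvPolynomial σ F, f ≠ 0 ∧ ∀ x : σ → F, MvPolynomial.eval x f ≠ 0 →
      ∃ ψ : B →ₐ[F] F, ψ.comp φ = MvPolynomial.aeval x := by
  have hfp : φ.toRingHom.FinitePresentation := by
    apply RingHom.FinitePresentation.of_finiteType.1
    have : (algebraMap F B) = φ.toRingHom.comp (algebraMap F (MvPolynomial σ F)) :=
      φ.comp_algebraMap.symm
    exact RingHom.FiniteType.of_comp_finiteType (f := algebraMap F (MvPolynomial σ F))
      (this ▸ RingHom.finiteType_algebraMap.2 inferInstance)
  obtain ⟨S, hS⟩ := PrimeSpectrum.exists_constructibleSetData_iff.2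
    (PrimeSpectrum.isConstructible_range_comap hfp)
  -- Injectivity of `φ` puts the generic point in the image. The constructible piece that contains
  -- it can have no nontrivial closed condition, so it is the basic open set of `C.f`.
  have hbot : (⊥ : PrimeSpectrum (MvPolynomial σ F)) ∈
      Set.range (PrimeSpectrum.comap φ.toRingHom) := by
    obtain ⟨Q, hQ, hQc⟩ := Ideal.exists_comap_eq_of_mem_minimalPrimes_of_injective
      (f := φ.toRingHom) hφ ⊥ (by simp [IsDomain.minimalPrimes_eq_singleton_bot])
    exact ⟨⟨Q, hQ⟩, PrimeSpectrum.ext hQc⟩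
  rw [← hS, PrimeSpectrum.ConstructibleSetData.toSet] at hbot
  simp only [Set.mem_iUnion] at hbot
  obtain ⟨C, hC, hCg, hCf⟩ := hbot
  have hg0 : ∀ i, C.g i = 0 := fun i => by
    have := hCg (Set.mem_range_self i)
    simpa using this
  refine ⟨C.f, fun h => hCf (by simp [h]), fun x hx => ?_⟩
  have hmem : MvPolynomial.pointToPoint (k := F) x ∈
      Set.range (PrimeSpectrum.comap φ.toRingHom) := by
    rw [← hS, PrimeSpectrum.ConstructibleSetData.toSet]
    simp only [Set.mem_iUnion]
    refine ⟨C, hC, ?_, ?_⟩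
    · rintro _ ⟨i, rfl⟩
      rw [hg0]
      exact zero_mem _
    · intro h
      have h' : C.f ∈ MvPolynomial.vanishingIdeal F {x} := h (Set.mem_singleton _)
      rw [MvPolynomial.mem_vanishingIdeal_singleton_iff] at h'
      exact hx h'
  obtain ⟨Q, hQ⟩ := hmem
  -- A prime over `x` makes the fibre nonempty; the Nullstellensatz gives it a rational point.
  obtain ⟨ψ⟩ := nonempty_algHom_of_finiteType (F := F) (B := B ⧸ Q.asIdeal)
  refine ⟨ψ.comp (Ideal.Quotient.mkₐ F Q.asIdeal), ?_⟩
  ext i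
  have hi : (MvPolynomial.X i - MvPolynomial.C (x i) : MvPolynomial σ F) ∈
      Ideal.comap φ.toRingHom Q.asIdeal := by
    have := congrArg PrimeSpectrum.asIdeal hQ
    change Ideal.comap φ.toRingHom Q.asIdeal = MvPolynomial.vanishingIdeal F {x} at this
    rw [this, MvPolynomial.mem_vanishingIdeal_singleton_iff]
    simp
  have hi' : φ (MvPolynomial.X i) - φ (MvPolynomial.C (x i)) ∈ Q.asIdeal := by
    rw [← map_sub]; exact hi
  have hi2 := Ideal.Quotient.eq.2 hi'
  simp only [AlgHom.comp_apply, Ideal.Quotient.mkₐ_eq_mk, MvPolynomial.aeval_X]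
  rw [hi2, ← MvPolynomial.algebraMap_eq, AlgHom.commutes]
  exact (ψ.comp (Ideal.Quotient.mkₐ F Q.asIdeal)).commutes (x i)

/-! ### Zariski closed and generic sets, coordinate rings. -/

section Zariski

variable {F : Type*} [Field F] {σ : Type*} {S : Set (σ → F)}

theorem isZariskiClosed_setOf_eval_eq_zero (f : MvPolynomial σ F) :
    IsZariskiClosed {x : σ → F | MvPolynomial.eval x f = 0} :=
  ⟨Ideal.span {f}, by
    ext x
    simp [MvPolynomial.zeroLocus_span, MvPolynomial.aeval_eq_eval]⟩

theorem isGeneric_of_eval_ne_zero {U : Set (σ → F)} (f : MvPolynomial σ F) (x₀ : σ → F)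
    (hx₀ : MvPolynomial.eval x₀ f ≠ 0)
    (hU : ∀ x : σ → F, MvPolynomial.eval x f ≠ 0 → x ∈ U) : IsGeneric U := by
  refine ⟨{x | MvPolynomial.eval x f ≠ 0}, ?_, ⟨x₀, hx₀⟩, hU⟩
  convert isZariskiClosed_setOf_eval_eq_zero f using 1
  ext x
  simp

theorem IsGeneric.nonempty {U : Set (σ → F)} (hU : IsGeneric U) : U.Nonempty := by
  obtain ⟨O, -, hO, hOU⟩ := hU
  exact hO.mono hOU

/-- A generic set is Zariski dense. -/
theorem IsGeneric.eq_zero_of_eval_eq_zero [Infinite F] {U : Set (σ → F)} (hU : IsGeneric U)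
    {P : MvPolynomial σ F} (hP : ∀ x ∈ U, MvPolynomial.eval x P = 0) : P = 0 := by
  obtain ⟨O, ⟨I, hI⟩, ⟨x₀, hx₀⟩, hOU⟩ := hU
  have hx₀' : x₀ ∉ MvPolynomial.zeroLocus F I := by
    rw [← hI]
    exact fun h => h hx₀
  rw [MvPolynomial.mem_zeroLocus_iff] at hx₀'
  push Not at hx₀'
  obtain ⟨f, hf, hfx⟩ := hx₀'
  have hPf : P * f = 0 := by
    refine MvPolynomial.funext fun x => ?_
    rw [map_mul, map_zero]
    by_cases hx : x ∈ O
    · rw [hP x (hOU hx), zero_mul]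
    · have hx' : x ∈ MvPolynomial.zeroLocus F I := hI ▸ hx
      have := hx' f hf
      rw [MvPolynomial.aeval_eq_eval] at this
      exact mul_eq_zero_of_right _ this
  refine (mul_eq_zero.1 hPf).resolve_right ?_
  rintro rfl
  simp at hfx

theorem IsZariskiClosed.zeroLocus_vanishingIdeal (hS : IsZariskiClosed S) :
    MvPolynomial.zeroLocus F (MvPolynomial.vanishingIdeal F S) = S := by
  obtain ⟨I, rfl⟩ := hS
  exact le_antisymm
    (MvPolynomial.zeroLocus_anti_mono (MvPolynomial.le_vanishingIdeal_zeroLocus I))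
    (MvPolynomial.zeroLocus_vanishingIdeal_le _)

theorem IsAffineVariety.isPrime_vanishingIdeal (hS : IsAffineVariety S) :
    (MvPolynomial.vanishingIdeal F S).IsPrime := by
  refine ⟨?_, ?_⟩
  · rw [Ideal.ne_top_iff_one]
    intro h
    obtain ⟨x, hx⟩ := hS.nonempty
    simpa using h x hx
  · intro p q hpq
    have := hS.irreducible _ _ (isZariskiClosed_setOf_eval_eq_zero p)
      (isZariskiClosed_setOf_eval_eq_zero q) (fun x hx => by
        have := hpq x hx
        rw [map_mul, mul_eq_zero] at this
        simpa [MvPolynomial.aeval_eq_eval] using this)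
    refine this.imp (fun h x hx => ?_) (fun h x hx => ?_)
    · rw [MvPolynomial.aeval_eq_eval]; exact h hx
    · rw [MvPolynomial.aeval_eq_eval]; exact h hx

/-- The class of a coordinate function in the coordinate ring. -/
def coordinate (S : Set (σ → F)) (i : σ) : CoordinateRing S :=
  Ideal.Quotient.mk _ (MvPolynomial.X i)

theorem adjoin_range_coordinate : Algebra.adjoin F (Set.range (coordinate S)) = ⊤ := by
  have : Set.range (coordinate S) = Ideal.Quotient.mkₐ F (MvPolynomial.vanishingIdeal F S) ''
      Set.range (MvPolynomial.X : σ → MvPolynomial σ F) := by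
    rw [← Set.range_comp]
    rfl
  rw [this, Algebra.adjoin_image, MvPolynomial.adjoin_range_X, Algebra.map_top,
    AlgHom.range_eq_top]
  exact Ideal.Quotient.mkₐ_surjective _ _

/-- Evaluation at a point, as a rational point of the coordinate ring. -/
theorem exists_algHom_coordinate {x : σ → F} (hx : x ∈ S) :
    ∃ ψ : CoordinateRing S →ₐ[F] F, ∀ i, ψ (coordinate S i) = x i :=
  ⟨Ideal.Quotient.liftₐ _ (MvPolynomial.aeval x) fun p hp => hp x hx, fun i => by
    simp [coordinate]⟩

theorem IsZariskiClosed.algHom_coordinate_mem (hS : IsZariskiClosed S)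
    (ψ : CoordinateRing S →ₐ[F] F) : (fun i => ψ (coordinate S i)) ∈ S := by
  refine hS.zeroLocus_vanishingIdeal.subset (MvPolynomial.mem_zeroLocus_iff.2 fun p hp => ?_)
  have h : (MvPolynomial.aeval fun i => ψ (coordinate S i)) =
      ψ.comp (Ideal.Quotient.mkₐ F (MvPolynomial.vanishingIdeal F S)) := by
    ext i
    simp [coordinate]
  rw [h, AlgHom.comp_apply, Ideal.Quotient.mkₐ_eq_mk, Ideal.Quotient.eq_zero_iff_mem.2 hp,
    map_zero]

end Zariski

/-! ### Coefficients of characteristic polynomials as coordinates. -/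

section Charpoly

theorem charpoly_eq_monicPoly_iff {F : Type*} [Field F] {n : ℕ} {N : Matrix (Fin n) (Fin n) F}
    {b : Fin n → F} :
    N.charpoly = monicPoly b ↔ ∀ i : Fin n, N.charpoly.coeff i.rev = b i := by
  have hrev (i : Fin n) : n - 1 - (i : ℕ) = (i.rev : ℕ) := by
    rw [Fin.val_rev]
    omega
  constructor
  · intro h i
    rw [h, monicPoly, coeff_add, coeff_X_pow, if_neg i.rev.isLt.ne, zero_add, finsetSum_coeff,
      Finset.sum_eq_single i]
    · rw [hrev, coeff_C_mul_X_pow, if_pos rfl]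
    · intro j _ hj
      rw [hrev, coeff_C_mul_X_pow, if_neg]
      exact fun h => hj (Fin.rev_injective (Fin.ext h.symm))
    · simp
  · intro h
    have hdeg : N.charpoly.natDegree = n := by
      simp
    rw [N.charpoly_monic.as_sum, hdeg, monicPoly, ← Fin.sum_univ_eq_sum_range
      (fun k => C (N.charpoly.coeff k) * X ^ k), ← Equiv.sum_comp Fin.revPerm]
    simp only [Fin.revPerm_apply, h, hrev]

theorem map_genericCharpolyCoeff {n : ℕ} {R K : Type*} [CommRing R] [CommRing K]
    (ψ : MvPolynomial (Fin n × Fin n) R →+* K) (z : Matrix (Fin n) (Fin n) R) (k : ℕ) :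
    ψ (genericCharpolyCoeff z k) =
      ((Matrix.of fun i j => ψ (MvPolynomial.X (i, j))) *
        (Matrix.of fun i j => ψ (MvPolynomial.C (z i j)))).charpoly.coeff k := by
  rw [genericCharpolyCoeff, ← Polynomial.coeff_map, ← Matrix.charpoly_map, Matrix.map_mul]
  rfl

theorem charpoly_mul_coeff_zero {R : Type*} [CommRing R] {n : ℕ}
    (M Z : Matrix (Fin n) (Fin n) R) :
    (M * Z).charpoly.coeff 0 = (-1) ^ n * M.det * Z.det := by
  have h := Matrix.det_eq_sign_charpoly_coeff (M * Z)
  rw [Matrix.det_mul, Fintype.card_fin] at h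
  rw [mul_assoc, h, ← mul_assoc, ← mul_pow]
  simp

end Charpoly

/-! ### Necessity of the two conditions. -/

section Variety

variable {F : Type*} [Field F] {n : ℕ} {𝒵 : Set (Matrix (Fin n) (Fin n) F)}

omit [Field F] in
theorem of_mem_of_mem_image_matrixCoords {x : Fin n × Fin n → F} (hx : x ∈ matrixCoords '' 𝒵) :
    (Matrix.of fun i j => x (i, j)) ∈ 𝒵 := by
  obtain ⟨Z, hZ, rfl⟩ := hx
  exact hZ

/-- The matrix of coordinate functions. -/
def coordinateMatrix (𝒵 : Set (Matrix (Fin n) (Fin n) F)) :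
    Matrix (Fin n) (Fin n) (CoordinateRing (matrixCoords '' 𝒵)) :=
  Matrix.of fun i j => coordinate _ (i, j)

theorem exists_algHom_map_coordinateMatrix {Z : Matrix (Fin n) (Fin n) F} (hZ : Z ∈ 𝒵) :
    ∃ ψ : CoordinateRing (matrixCoords '' 𝒵) →ₐ[F] F, (coordinateMatrix 𝒵).map ψ = Z := by
  obtain ⟨ψ, hψ⟩ := exists_algHom_coordinate (S := matrixCoords '' 𝒵) ⟨Z, hZ, rfl⟩
  refine ⟨ψ, ?_⟩
  ext i j
  exact hψ (i, j)

theorem map_coordinateMatrix_mem (h𝒵 : IsZariskiClosed (matrixCoords '' 𝒵))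
    (ψ : CoordinateRing (matrixCoords '' 𝒵) →ₐ[F] F) :
    (Matrix.of fun i j => ψ (coordinateMatrix 𝒵 i j)) ∈ 𝒵 :=
  of_mem_of_mem_image_matrixCoords (h𝒵.algHom_coordinate_mem ψ)

/-- If a generic polynomial is attained for one matrix `M`, then the coefficients of the
characteristic polynomial are algebraically independent functions on the variety. -/
theorem le_varietyDim_of_isGeneric [IsAlgClosed F]
    (h𝒵 : IsAffineVariety (matrixCoords '' 𝒵)) {M : Matrix (Fin n) (Fin n) F}
    (hM : IsGeneric {b : Fin n → F | HasSolution 𝒵 M (monicPoly b)}) :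
    (n : WithBot ℕ∞) ≤ varietyDim (matrixCoords '' 𝒵) := by
  have := h𝒵.isPrime_vanishingIdeal
  have : Infinite F := IsAlgClosed.instInfinite
  set R := CoordinateRing (matrixCoords '' 𝒵)
  let v : Fin n → R := fun i =>
    (M.map (algebraMap F R) * coordinateMatrix 𝒵).charpoly.coeff i.rev
  have hv : AlgebraicIndependent F v := by
    -- A relation among the coefficient functions vanishes at every attained `b`, hence on a dense
    -- set.
    refine (injective_iff_map_eq_zero _).2 fun P hP => hM.eq_zero_of_eval_eq_zero ?_
    rintro b ⟨Z, hZ, hb⟩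
    obtain ⟨ψ, hψ⟩ := exists_algHom_map_coordinateMatrix hZ
    have hb' : b = fun i => ψ (v i) := by
      funext i
      rw [← charpoly_eq_monicPoly_iff.1 hb i]
      have h1 : (M * Z) = (M.map (algebraMap F R) * coordinateMatrix 𝒵).map ψ := by
        rw [Matrix.map_mul, hψ]
        congr 1
        ext i j
        simp
      rw [h1]
      have := Matrix.charpoly_map (M.map (algebraMap F R) * coordinateMatrix 𝒵) (ψ : R →+* F)
      change ((M.map (algebraMap F R) * coordinateMatrix 𝒵).map (ψ : R →+* F)).charpoly.coeff _ = _
      rw [this, Polynomial.coeff_map]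
      rfl
    rw [hb', ← MvPolynomial.aeval_eq_eval]
    have := congrArg ψ hP
    rw [map_zero, ← AlgHom.comp_apply, MvPolynomial.comp_aeval] at this
    exact this
  rw [varietyDim, natCast_le_ringKrullDim_iff (F := F)]
  simpa using hv.lift_cardinalMk_le_trdeg

/-- A constant determinant prescribes the constant term of the attained polynomials. -/
theorem not_isGeneric_of_det_eq [Infinite F] (hn : 0 < n) {c : F} (hc : ∀ Z ∈ 𝒵, Z.det = c)
    (M : Matrix (Fin n) (Fin n) F) :
    ¬ IsGeneric {b : Fin n → F | HasSolution 𝒵 M (monicPoly b)} := by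
  intro hM
  -- Coordinates run from the top degree down, so the last index is the constant term.
  let i : Fin n := Fin.rev ⟨0, hn⟩
  let a : F := (-1) ^ n * M.det * c
  have h0 : (MvPolynomial.X i - MvPolynomial.C a : MvPolynomial (Fin n) F) = 0 := by
    refine hM.eq_zero_of_eval_eq_zero ?_
    rintro b ⟨Z, hZ, hb⟩
    have := charpoly_eq_monicPoly_iff.1 hb i
    simp only [i, Fin.rev_rev, charpoly_mul_coeff_zero, hc Z hZ] at this
    simp [i, a, this]
  have := congrArg (MvPolynomial.eval fun _ => a + 1) h0
  simp at this

end Variety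

/-! ### Sufficiency and the equivalence. -/

/-- The polynomials attained by a variety of large dimension with nonconstant determinant. -/
theorem genericallySolvable_of_le_varietyDim {F : Type u} [Field F] [IsAlgClosed F] {n : ℕ}
    (hn : 0 < n) {𝒵 : Set (Matrix (Fin n) (Fin n) F)}
    (h𝒵 : IsAffineVariety (matrixCoords '' 𝒵))
    (hdim : (n : WithBot ℕ∞) ≤ varietyDim (matrixCoords '' 𝒵))
    (hdet : ¬ ∃ c : F, ∀ Z ∈ 𝒵, Z.det = c) : GenericallySolvable 𝒵 := by
  obtain ⟨m, rfl⟩ : ∃ m, n = m + 1 := ⟨n - 1, by omega⟩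
  have := h𝒵.isPrime_vanishingIdeal
  have : Infinite F := IsAlgClosed.instInfinite
  set R := CoordinateRing (matrixCoords '' 𝒵)
  set z := coordinateMatrix 𝒵
  rw [varietyDim, natCast_le_ringKrullDim_iff (F := F)] at hdim
  have hz : z.det ∉ Set.range (algebraMap F R) := by
    rintro ⟨c, hc⟩
    refine hdet ⟨c, fun Z hZ => ?_⟩
    obtain ⟨ψ, rfl⟩ := exists_algHom_map_coordinateMatrix hZ
    have h1 := congrArg ψ hc
    rw [AlgHom.commutes] at h1
    exact ((AlgHom.map_det ψ z).symm.trans h1.symm)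
  obtain ⟨f, hf0, hf⟩ := exists_ne_zero_forall_lift _
    (algebraicIndependent_genericCharpolyCoeff hz adjoin_range_coordinate hdim)
  obtain ⟨x₀, hx₀⟩ : ∃ x, MvPolynomial.eval x f ≠ 0 := by
    by_contra! h
    exact hf0 (MvPolynomial.funext fun x => by rw [h, map_zero])
  -- Freezing the coefficients at `b₀` cuts out an open set of matrices; for each of these, `b₀`
  -- itself witnesses that the open set of polynomials is nonempty.
  let b₀ : Fin (m + 1) → F := fun i => x₀ (Sum.inr i)
  have hx₀' : Sum.elim (fun ij => x₀ (Sum.inl ij)) b₀ = x₀ := by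
    funext s
    cases s <;> rfl
  refine isGeneric_of_eval_ne_zero
    (MvPolynomial.aeval (Sum.elim MvPolynomial.X fun i => MvPolynomial.C (b₀ i)) f)
    (fun ij => x₀ (Sum.inl ij)) ?_ fun y hy => ?_
  · rw [← MvPolynomial.aeval_eq_eval, ← AlgHom.comp_apply, MvPolynomial.comp_aeval]
    convert hx₀ using 1
    rw [← MvPolynomial.aeval_eq_eval]
    congr 2
    funext s
    cases s <;> simp [b₀]
  refine ⟨Matrix.of fun i j => y (i, j), ?_, rfl⟩
  refine isGeneric_of_eval_ne_zero
    (MvPolynomial.aeval (Sum.elim (fun ij => MvPolynomial.C (y ij))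
      fun i : Fin (m + 1) => MvPolynomial.X i.rev) f)
    (fun i => b₀ i.rev) ?_ fun b hb => ?_
  · convert hy using 1
    rw [← MvPolynomial.aeval_eq_eval, ← AlgHom.comp_apply, MvPolynomial.comp_aeval,
      ← MvPolynomial.aeval_eq_eval, ← AlgHom.comp_apply, MvPolynomial.comp_aeval]
    congr 2
    funext s
    cases s <;> simp
  have hb' : MvPolynomial.eval (Sum.elim y fun i => b i.rev) f ≠ 0 := by
    convert hb using 1
    rw [← MvPolynomial.aeval_eq_eval, ← MvPolynomial.aeval_eq_eval, ← AlgHom.comp_apply,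
      MvPolynomial.comp_aeval]
    congr 2
    funext s
    cases s <;> simp
  obtain ⟨ψ, hψ⟩ := hf _ hb'
  have hψX (ij) : ψ (MvPolynomial.X ij) = y ij := by
    simpa using DFunLike.congr_fun hψ (MvPolynomial.X (Sum.inl ij))
  have hψc (l : Fin (m + 1)) : ψ (genericCharpolyCoeff z l) = b l.rev := by
    simpa using DFunLike.congr_fun hψ (MvPolynomial.X (Sum.inr l))
  -- Restricting the rational point to the constants `R` gives the solution `Z` on the variety.
  let ψ' : R →ₐ[F] F := ψ.comp (Algebra.ofId R (MvPolynomial _ R) |>.restrictScalars F)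
  refine ⟨_, map_coordinateMatrix_mem h𝒵.closed ψ', charpoly_eq_monicPoly_iff.2 fun i => ?_⟩
  have h1 := map_genericCharpolyCoeff (ψ : MvPolynomial _ R →+* F) z i.rev
  have h2 := hψc i.rev
  rw [Fin.rev_rev] at h2
  rw [← h2]
  refine Eq.trans ?_ h1.symm
  congr 3
  ext i j
  exact (hψX (i, j)).symm

end InverseEigenvalue

end

theorem theorem3p1 {F : Type*} [Field F] [IsAlgClosed F] {n : ℕ} (hn : 0 < n)
    (𝒵 : Set (Matrix (Fin n) (Fin n) F))
    (h𝒵 : InverseEigenvalue.IsAffineVariety (InverseEigenvalue.matrixCoords '' 𝒵)) :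
    InverseEigenvalue.GenericallySolvable 𝒵 ↔
      (n : WithBot ℕ∞) ≤
          InverseEigenvalue.varietyDim (InverseEigenvalue.matrixCoords '' 𝒵) ∧
        ¬ ∃ c : F, ∀ Z ∈ 𝒵, Z.det = c := by
  refine ⟨fun h => ?_, fun h => InverseEigenvalue.genericallySolvable_of_le_varietyDim hn h𝒵 h.1 h.2⟩
  have : Infinite F := IsAlgClosed.instInfinite
  obtain ⟨_, M, hM, -⟩ := InverseEigenvalue.IsGeneric.nonempty h
  refine ⟨InverseEigenvalue.le_varietyDim_of_isGeneric h𝒵 hM, ?_⟩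
  rintro ⟨c, hc⟩
  exact InverseEigenvalue.not_isGeneric_of_det_eq hn hc M hM
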